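/- Throughout, digraphs have no parallel arcs, but two opposite arcs $uv$ and $vu$ may both be present. The chromatic number $\chi(D)$ of a digraph $D$ is the chromatic number of its underlying simple graph. A digraph is strongly connected if for any two vertices $u,v$ it has a directed path from $u$ to $v$. For positive integers $k,\ell$ with $k+\ell\ge 3$, let $C(k,\ell)$ denote the oriented cycle with two blocks, one of length $k$ and one of length $\ell$; that is, the union of a directed path of length $k$ and a directed path of length $\ell$ that have the same initial vertex and the same terminal vertex and are otherwise disjoint. A subdivision of a digraph $H$ is a digraph obtained from $H$ by replacing each arc $uv$ by a directed path of length at least $1$ from $u$ to $v$, these paths being internally disjoint from each other and from the vertices of $H$. **Theorem.** Let $k$ and $\ell$ be two positive integers such that $k\geq \max\{\ell,3\}$, and let $D$ be a strongly connected digraph that contains no subdivision of $C(k,\ell)$ as a subdigraph. Then $$\chi(D)\le (k+\ell-2)(k+\ell-3)(2\ell+2)(k+\ell+1).$$ -/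

import Mathlib

/-- `p` is a dipath of `D` with initial vertex `u` and terminal vertex `v`: the list of the
(pairwise distinct) vertices of a directed path with forward arcs only. Its length, that is its
number of arcs, is `p.length - 1`. -/
def IsDipath {V : Type*} (D : Digraph V) (u v : V) (p : List V) : Prop :=
  p.head? = some u ∧ p.getLast? = some v ∧ p.IsChain D.Adj ∧ p.Nodup

/-- `D` is strongly connected: there is a `(u, v)`-dipath for any two vertices `u`, `v`. -/
def IsStrong {V : Type*} (D : Digraph V) : Prop :=
  ∀ u v : V, ∃ p : List V, IsDipath D u v p

/-- The chromatic number of a digraph is that of its underlying simple graph, in which `u ≠ v` are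
adjacent when `uv` or `vu` is an arc. -/
noncomputable def digraphChromaticNumber {V : Type*} (D : Digraph V) : ℕ∞ :=
  D.toSimpleGraphInclusive.chromaticNumber

/-- `D` contains, as a subdigraph, a subdivision of the loopless digraph `H`: the vertices `w` of
`H` are mapped to distinct vertices `f w` of `D`, and every arc `ab` of `H` is replaced by a dipath
`P a b` of `D` from `f a` to `f b`, such that `P a b` meets the image of `f` only in its two ends
and the dipaths of two distinct arcs meet only in the image of `f`.
(As `H` has no loop, the ends are distinct and each dipath has length at least one.) -/
def ContainsSubdivision {W V : Type*} (H : Digraph W) (D : Digraph V) : Prop :=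
  ∃ (f : W → V) (P : W → W → List V),
    Function.Injective f ∧
    (∀ a b, H.Adj a b → IsDipath D (f a) (f b) (P a b)) ∧
    (∀ a b, H.Adj a b → ∀ w, f w ∈ P a b → w = a ∨ w = b) ∧
    (∀ a b c d, H.Adj a b → H.Adj c d → (a, b) ≠ (c, d) →
      ∀ x, x ∈ P a b → x ∈ P c d → x ∈ Set.range f)

/-- The oriented cycle `C(k, ℓ)` with two blocks, one of length `k` and one of length `ℓ`.
Running through the cycle `0, 1, …, k + ℓ - 1, 0`, the first `k` arcs `i → i + 1` are forward and
the last `ℓ` arcs `i ← i + 1` (indices modulo `k + ℓ`) are backward; so the two blocks are the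
dipaths `0 → 1 → ⋯ → k` and `0 → k + ℓ - 1 → ⋯ → k`. -/
def twoBlockCycle (k l : ℕ) : Digraph (Fin (k + l)) where
  Adj u v := (u.val < k ∧ v.val = u.val + 1) ∨ (k ≤ v.val ∧ u.val = (v.val + 1) % (k + l))

/-! Long directed cycles are contracted until only short ones remain. In a finite strong digraph,
start from singleton classes and repeatedly merge the classes met by a longest cycle of the
quotient, as long as its length is at least `4k - 4`. The invariant `closed` says that such a cycle
enters and leaves every class at the same vertex, so it is a genuine directed cycle of the digraph.
Maximality preserves the invariant: a violation would give two internally disjoint long dipaths with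
common ends (`NoTwoBlocks.closed_mergeFibres`).

When the process stops, the quotient is strong with all cycles of length at most `4k - 5`, so
Bondy's theorem colours it with `4k - 5` colours. This separates adjacent vertices of different
classes.

Inside a class, long cycles are glued like a cactus. Two labels suffice there. The label `ψ`, with
`k + l + 1` values, separates adjacent vertices of one glued cycle, because the digraph on the
vertices of a directed cycle is `(k + l)`-degenerate (`NoTwoBlocks.exists_degree_le`). The label
`φ`, modulo `4l - 3`, increases by one or two along the glued cycles. If an arc joins vertices on
different sides of a cut vertex, the absence of two blocks forces a dipath of at most `2l - 2`
cactus arcs between its ends. Its potential increase lies strictly between `0` and `4l - 3`, so `φ`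
differs (`NoTwoBlocks.potential_ne`).

The triple of labels uses `(4k - 5)(4l - 3)(k + l + 1)` colours, which is within the claimed bound.
Infinite digraphs are handled by compactness. -/

/-! ### Paths with a recorded vertex set -/

/-- There is a path of the relation `R` from `u` to `v` with exactly `n` arcs, pairwise distinct
vertices, and all vertices in `S`. -/
def HasPath {V : Type*} (R : V → V → Prop) (S : Set V) (u v : V) (n : ℕ) : Prop :=
  ∃ p : ℕ → V, p 0 = u ∧ p n = v ∧ (∀ i < n, R (p i) (p (i + 1))) ∧
    (∀ i ≤ n, ∀ j ≤ n, p i = p j → i = j) ∧ ∀ i ≤ n, p i ∈ S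

namespace HasPath

variable {V : Type*} {R R' : V → V → Prop} {S T : Set V} {u v w z : V} {m n : ℕ}

theorem refl (hu : u ∈ S) : HasPath R S u u 0 :=
  ⟨fun _ => u, rfl, rfl, by simp, by intro i hi j hj _; omega, fun _ _ => hu⟩

theorem mono (h : HasPath R S u v n) (hR : ∀ a ∈ S, ∀ b ∈ S, R a b → R' a b) (hS : S ⊆ T) :
    HasPath R' T u v n := by
  obtain ⟨p, h0, h1, h2, h3, h4⟩ := h
  exact ⟨p, h0, h1, fun i hi => hR _ (h4 _ (by omega)) _ (h4 _ (by omega)) (h2 i hi), h3,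
    fun i hi => hS (h4 i hi)⟩

theorem mono_set (h : HasPath R S u v n) (hS : S ⊆ T) : HasPath R T u v n :=
  h.mono (fun _ _ _ _ h => h) hS

theorem left_mem (h : HasPath R S u v n) : u ∈ S := by
  obtain ⟨p, h0, -, -, -, h4⟩ := h
  exact h0 ▸ h4 0 (by omega)

theorem right_mem (h : HasPath R S u v n) : v ∈ S := by
  obtain ⟨p, -, h1, -, -, h4⟩ := h
  exact h1 ▸ h4 n le_rfl

theorem pos_of_ne (h : HasPath R S u v n) (huv : u ≠ v) : 0 < n := by
  obtain ⟨p, h0, h1, -, -, -⟩ := h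
  rcases Nat.eq_zero_or_pos n with rfl | hn
  · exact absurd (h0.symm.trans h1) huv
  · exact hn

theorem concat (h : HasPath R S u v n) (h' : HasPath R T v w m) (hST : S ∩ T ⊆ {v}) :
    HasPath R (S ∪ T) u w (n + m) := by
  obtain ⟨p, p0, p1, p2, p3, p4⟩ := h
  obtain ⟨q, q0, q1, q2, q3, q4⟩ := h'
  have key : ∀ i ≤ n, ∀ j ≤ m, p i = q j → i = n ∧ j = 0 := by
    intro i hi j hj hij
    have : p i = v := hST ⟨p4 i hi, hij ▸ q4 j hj⟩
    exact ⟨p3 i hi n le_rfl (this.trans p1.symm),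
      q3 j hj 0 (by omega) ((hij.symm.trans this).trans q0.symm)⟩
  refine ⟨fun i => if i ≤ n then p i else q (i - n), by simp [p0], ?_, ?_, ?_, ?_⟩
  · by_cases hm : m = 0
    · subst hm; simp [p1, ← q1, q0]
    · have : ¬ n + m ≤ n := by omega
      simp only [this, if_false, Nat.add_sub_cancel_left, q1]
  · intro i hi
    by_cases h1 : i + 1 ≤ n
    · have h2 : i ≤ n := by omega
      simp only [h1, h2, if_true]; exact p2 i (by omega)
    · by_cases h2 : i ≤ n
      · have : i = n := by omega
        subst this
        simp only [le_refl, if_true, h1, if_false, Nat.add_sub_cancel_left]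
        rw [p1, ← q0]; exact q2 0 (by omega)
      · simp only [h1, h2, if_false]
        rw [show i + 1 - n = (i - n) + 1 by omega]
        exact q2 _ (by omega)
  · intro i hi j hj hij
    by_cases h1 : i ≤ n <;> by_cases h2 : j ≤ n <;> simp only [h1, h2, if_true, if_false] at hij
    · exact p3 i h1 j h2 hij
    · have := key i h1 (j - n) (by omega) hij; omega
    · have := key j h2 (i - n) (by omega) hij.symm; omega
    · have := q3 (i - n) (by omega) (j - n) (by omega) hij; omega
  · intro i hi
    by_cases h1 : i ≤ n <;> simp only [h1, if_true, if_false]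
    · exact Or.inl (p4 i h1)
    · exact Or.inr (q4 _ (by omega))

theorem arc (h : R u v) (huv : u ≠ v) : HasPath R {u, v} u v 1 := by
  refine ⟨fun i => if i = 0 then u else v, by simp, by simp, ?_, ?_, ?_⟩
  · intro i hi
    have : i = 0 := by omega
    subst this; simpa using h
  · intro i hi j hj hij
    by_cases h1 : i = 0 <;> by_cases h2 : j = 0 <;> simp only [h1, h2, if_true, if_false] at hij
    · omega
    · exact absurd hij huv
    · exact absurd hij.symm huv
    · omega
  · intro i hi
    by_cases h1 : i = 0 <;> simp [h1]

theorem snoc (h : HasPath R S u v n) (hr : R v w) (hw : w ∉ S) :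
    HasPath R (S ∪ {w}) u w (n + 1) := by
  have hv := h.right_mem
  have hne : v ≠ w := fun e => hw (e ▸ hv)
  refine (h.concat (arc hr hne) ?_).mono_set ?_
  · rintro x ⟨hx, rfl | rfl⟩
    · rfl
    · exact absurd hx hw
  · rintro x (hx | rfl | rfl)
    · exact Or.inl hx
    · exact Or.inl hv
    · exact Or.inr rfl

theorem cons (h : HasPath R S v w n) (hr : R u v) (hu : u ∉ S) :
    HasPath R ({u} ∪ S) u w (n + 1) := by
  have hv := h.left_mem
  have hne : u ≠ v := fun e => hu (e ▸ hv)
  rw [add_comm]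
  refine ((arc hr hne).concat h ?_).mono_set ?_
  · rintro x ⟨rfl | rfl, hx⟩
    · exact absurd hx hu
    · rfl
  · rintro x ((rfl | rfl) | hx)
    · exact Or.inl rfl
    · exact Or.inr hv
    · exact Or.inr hx

/-- A segment of an injective sequence of arcs is a path. -/
theorem of_seq (c : ℕ → V) {a b : ℕ} (hab : a ≤ b)
    (hR : ∀ i, a ≤ i → i < b → R (c i) (c (i + 1)))
    (hinj : ∀ i j, a ≤ i → i ≤ b → a ≤ j → j ≤ b → c i = c j → i = j) :
    HasPath R (c '' Set.Icc a b) (c a) (c b) (b - a) := by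
  refine ⟨fun i => c (a + i), by simp, ?_, ?_, ?_, ?_⟩
  · simp only; congr 1; omega
  · intro i hi; exact hR _ (by omega) (by omega)
  · intro i hi j hj hij
    have := hinj _ _ (by omega) (by omega) (by omega) (by omega) hij
    omega
  · intro i hi; exact ⟨a + i, ⟨by omega, by omega⟩, rfl⟩

theorem of_reflTransGen (h : Relation.ReflTransGen R u v) :
    ∃ n, HasPath R Set.univ u v n := by
  induction h with
  | refl => exact ⟨0, refl trivial⟩
  | @tail b c _ hbc ih =>
    obtain ⟨n, p, p0, p1, p2, p3, -⟩ := ih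
    -- If the new vertex already lies on the path, the path is cut at that occurrence.
    by_cases hc : ∃ i ≤ n, p i = c
    · obtain ⟨i, hi, hic⟩ := hc
      exact ⟨i, p, p0, hic, fun j hj => p2 j (by omega),
        fun a ha b hb => p3 a (by omega) b (by omega), fun _ _ => trivial⟩
    · push Not at hc
      have hp : HasPath R {x | ∃ i ≤ n, p i = x} u b n :=
        ⟨p, p0, p1, p2, p3, fun i hi => ⟨i, hi, rfl⟩⟩
      exact ⟨n + 1, (hp.snoc hbc (by rintro ⟨i, hi, h⟩; exact hc i hi h)).mono_set
        (Set.subset_univ _)⟩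

end HasPath

/-! ### Two-block cycles and subdivisions of `C(k, ℓ)` -/

/-- There are no two internally disjoint paths with common ends, one with at least `k` and the
other with at least `l` arcs. -/
def NoTwoBlocks {V : Type*} (R : V → V → Prop) (k l : ℕ) : Prop :=
  ∀ (S T : Set V) (a b : V) (m n : ℕ), a ≠ b → HasPath R S a b m → HasPath R T a b n →
    S ∩ T ⊆ {a, b} → k ≤ m → l ≤ n → False

theorem isDipath_map_range' {V : Type*} (D : Digraph V) (p : ℕ → V) {a b : ℕ} (hab : a ≤ b)
    (hR : ∀ i, a ≤ i → i < b → D.Adj (p i) (p (i + 1)))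
    (hinj : ∀ i j, a ≤ i → i ≤ b → a ≤ j → j ≤ b → p i = p j → i = j) :
    IsDipath D (p a) (p b) ((List.range' a (b - a + 1)).map p) := by
  refine ⟨by simp [List.head?_range'], ?_, ?_, ?_⟩
  · rw [List.getLast?_map, List.getLast?_range']
    simp; congr 1; omega
  · rw [List.isChain_iff_getElem]
    intro i hi
    simp at hi
    simp only [List.getElem_map, List.getElem_range', one_mul]
    exact hR _ (by omega) (by omega)
  · refine List.Nodup.map_on ?_ List.nodup_range'
    intro x hx y hy hxy
    simp [List.mem_range'_1] at hx hy
    exact hinj x y (by omega) (by omega) (by omega) (by omega) hxy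

/-- In each block all arcs but the last are kept as single arcs, and the last one absorbs the
surplus length of `p` or `q`. -/
theorem containsSubdivision_twoBlockCycle {V : Type*} (D : Digraph V) {k l m n : ℕ}
    (hk : 2 ≤ k) (hl : 1 ≤ l) (p q : ℕ → V) (hm : k ≤ m) (hn : l ≤ n)
    (hp : ∀ i < m, D.Adj (p i) (p (i + 1))) (hq : ∀ i < n, D.Adj (q i) (q (i + 1)))
    (pinj : ∀ i ≤ m, ∀ j ≤ m, p i = p j → i = j) (qinj : ∀ i ≤ n, ∀ j ≤ n, q i = q j → i = j)
    (h0 : p 0 = q 0) (h1 : p m = q n)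
    (hpq : ∀ i ≤ m, ∀ j ≤ n, p i = q j → (i = 0 ∧ j = 0) ∨ (i = m ∧ j = n)) :
    ContainsSubdivision (twoBlockCycle k l) D := by
  -- The `i`-th arc of a block is replaced by the segment of `p` from `i` to `e i`, or of `q` from
  -- `i` to `e' i`.
  let e : ℕ → ℕ := fun i => if i + 1 < k then i + 1 else m
  let e' : ℕ → ℕ := fun j => if j + 1 < l then j + 1 else n
  -- The second block runs backwards through the numbering, so its `j`-th vertex is number `k + l -
  -- j`.
  let f : Fin (k + l) → V := fun i =>
    if i.val < k then p i.val else if i.val = k then p m else q (k + l - i.val)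
  let P : Fin (k + l) → Fin (k + l) → List V := fun u v =>
    if u.val < k ∧ v.val = u.val + 1 then (List.range' u.val (e u.val - u.val + 1)).map p
    else (List.range' (k + l - 1 - v.val)
      (e' (k + l - 1 - v.val) - (k + l - 1 - v.val) + 1)).map q
  have ee : ∀ i, i < k → i < e i ∧ e i ≤ m ∧ (i + 1 < k → e i = i + 1) ∧
      (i + 1 = k → e i = m) := by
    intro i hi
    simp only [e]; split_ifs <;> omega
  have ee' : ∀ i, i < l → i < e' i ∧ e' i ≤ n ∧ (i + 1 < l → e' i = i + 1) ∧
      (i + 1 = l → e' i = n) := by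
    intro i hi
    simp only [e']; split_ifs <;> omega
  have fp : ∀ i : Fin (k + l), i.val < k → f i = p i.val := by
    intro i hi; simp only [f, hi, if_true]
  have fk : ∀ i : Fin (k + l), i.val = k → f i = p m := by
    intro i hi
    simp [f, hi]
  have fq : ∀ i : Fin (k + l), k < i.val → f i = q (k + l - i.val) := by
    intro i hi
    have h1 : ¬ i.val < k := by omega
    have h2 : ¬ i.val = k := by omega
    simp only [f, h1, h2, if_false]
  have adj : ∀ a b : Fin (k + l), (twoBlockCycle k l).Adj a b →
      (a.val < k ∧ b.val = a.val + 1 ∧ f a = p a.val ∧ f b = p (e a.val) ∧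
        P a b = (List.range' a.val (e a.val - a.val + 1)).map p) ∨
      (¬ (a.val < k ∧ b.val = a.val + 1) ∧ ∃ j < l, b.val = k + l - 1 - j ∧
        a.val = (b.val + 1) % (k + l) ∧ f a = q j ∧ f b = q (e' j) ∧
        P a b = (List.range' j (e' j - j + 1)).map q) := by
    intro a b hab
    by_cases h : a.val < k ∧ b.val = a.val + 1
    · refine Or.inl ⟨h.1, h.2, fp a h.1, ?_, by simp only [P]; rw [if_pos h]⟩
      obtain ⟨-, -, h3, h4⟩ := ee a.val h.1
      by_cases hlt : a.val + 1 < k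
      · rw [h3 hlt, fp b (by omega), h.2]
      · rw [h4 (by omega), fk b (by omega)]
    · refine Or.inr ⟨h, k + l - 1 - b.val, ?_, by omega, ?_, ?_, ?_, ?_⟩
      all_goals
        have hb : k ≤ b.val ∧ a.val = (b.val + 1) % (k + l) := by
          rcases hab with hab | hab
          · exact absurd hab h
          · exact hab
        have hbl := b.isLt
      · omega
      · exact hb.2
      · by_cases hbe : b.val + 1 = k + l
        · have ha : a.val = 0 := by rw [hb.2, hbe, Nat.mod_self]
          rw [fp a (by omega), ha, h0]; congr 1; omega
        · have ha : a.val = b.val + 1 := by rw [hb.2, Nat.mod_eq_of_lt (by omega)]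
          rw [fq a (by omega), ha]; congr 1; omega
      · obtain ⟨-, -, h3, h4⟩ := ee' (k + l - 1 - b.val) (by omega)
        by_cases hbk : b.val = k
        · rw [fk b hbk, h4 (by omega), h1]
        · rw [fq b (by omega), h3 (by omega)]; congr 1; omega
      · simp only [P]; rw [if_neg h]
  have finj : Function.Injective f := by
    have aux : ∀ i : Fin (k + l), (i.val < k ∧ f i = p i.val) ∨ (i.val = k ∧ f i = p m) ∨
        (k < i.val ∧ f i = q (k + l - i.val)) := by
      intro i
      rcases lt_trichotomy i.val k with h | h | h
      · exact Or.inl ⟨h, fp i h⟩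
      · exact Or.inr (Or.inl ⟨h, fk i h⟩)
      · exact Or.inr (Or.inr ⟨h, fq i h⟩)
    intro a b hab
    apply Fin.ext
    have ha := a.isLt
    have hb := b.isLt
    rcases aux a with ⟨h, e1⟩ | ⟨h, e1⟩ | ⟨h, e1⟩ <;>
      rcases aux b with ⟨h', e2⟩ | ⟨h', e2⟩ | ⟨h', e2⟩ <;> rw [e1, e2] at hab
    · exact pinj _ (by omega) _ (by omega) hab
    · have := pinj _ (by omega) _ (by omega) hab; omega
    · have := hpq _ (by omega) _ (by omega) hab; omega
    · have := pinj _ (by omega) _ (by omega) hab; omega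
    · omega
    · have := hpq _ (by omega) _ (by omega) hab; omega
    · have := hpq _ (by omega) _ (by omega) hab.symm; omega
    · have := hpq _ (by omega) _ (by omega) hab.symm; omega
    · have := qinj _ (by omega) _ (by omega) hab; omega
  have mem : ∀ (r : ℕ → V) (a b : ℕ) (x : V), a ≤ b →
      x ∈ (List.range' a (b - a + 1)).map r → ∃ t, a ≤ t ∧ t ≤ b ∧ r t = x := by
    intro r a b x hab hx
    obtain ⟨t, ht, rfl⟩ := List.mem_map.1 hx
    rw [List.mem_range'_1] at ht
    exact ⟨t, ht.1, by omega, rfl⟩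
  -- interior vertices of the subdivided arcs are not branch vertices
  have branch : ∀ a b, (twoBlockCycle k l).Adj a b → ∀ x ∈ P a b,
      x = f a ∨ x = f b ∨ ((∃ t, 0 < t ∧ t < m ∧ x = p t ∧ a.val < t ∧ t < e a.val ∧ a.val < k) ∨
        ∃ t, 0 < t ∧ t < n ∧ x = q t ∧ l ≤ t) := by
    intro a b hab x hx
    rcases adj a b hab with ⟨h, h', e1, e2, e3⟩ | ⟨h, j, hj, hb, ha, e1, e2, e3⟩
    · rw [e3] at hx
      obtain ⟨g1, g2, -⟩ := ee a.val h
      obtain ⟨t, t1, t2, rfl⟩ := mem _ _ _ _ g1.le hx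
      by_cases c1 : t = a.val
      · subst c1; exact Or.inl e1.symm
      by_cases c2 : t = e a.val
      · subst c2; exact Or.inr (Or.inl e2.symm)
      exact Or.inr (Or.inr (Or.inl ⟨t, by omega, by omega, rfl, by omega, by omega, h⟩))
    · rw [e3] at hx
      obtain ⟨g1, g2, g3, g4⟩ := ee' j hj
      obtain ⟨t, t1, t2, rfl⟩ := mem _ _ _ _ g1.le hx
      by_cases c1 : t = j
      · subst c1; exact Or.inl e1.symm
      by_cases c2 : t = e' j
      · subst c2; exact Or.inr (Or.inl e2.symm)
      refine Or.inr (Or.inr (Or.inr ⟨t, by omega, by omega, rfl, ?_⟩))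
      by_cases c3 : j + 1 < l
      · have := g3 c3; omega
      · omega
  have frange : ∀ w, (∃ t, t < k ∧ f w = p t) ∨ f w = p m ∨ ∃ t, 0 < t ∧ t < l ∧ f w = q t := by
    intro w
    have := w.isLt
    rcases lt_trichotomy w.val k with h | h | h
    · exact Or.inl ⟨_, h, fp w h⟩
    · exact Or.inr (Or.inl (fk w h))
    · exact Or.inr (Or.inr ⟨_, by omega, by omega, fq w h⟩)
  refine ⟨f, P, finj, ?_, ?_, ?_⟩
  · intro a b hab
    rcases adj a b hab with ⟨h, h', e1, e2, e3⟩ | ⟨h, j, hj, hb, ha, e1, e2, e3⟩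
    · rw [e1, e2, e3]
      obtain ⟨g1, g2, -⟩ := ee a.val h
      exact isDipath_map_range' D p g1.le (fun i _ hi => hp i (by omega))
        (fun i j _ hi _ hj => pinj i (by omega) j (by omega))
    · rw [e1, e2, e3]
      obtain ⟨g1, g2, -⟩ := ee' j hj
      exact isDipath_map_range' D q g1.le (fun i _ hi => hq i (by omega))
        (fun i j _ hi _ hj => qinj i (by omega) j (by omega))
  · intro a b hab w hw
    rcases branch a b hab _ hw with h | h | ⟨t, t0, tm, h, ha, hb, hk'⟩ | ⟨t, t0, tm, h, htl⟩
    · exact Or.inl (finj h)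
    · exact Or.inr (finj h)
    · exfalso
      obtain ⟨g1, g2, g3, g4⟩ := ee a.val hk'
      rcases frange w with ⟨s, hs, e1⟩ | e1 | ⟨s, s0, hs, e1⟩ <;> rw [e1] at h
      · have := pinj _ (by omega) _ (by omega) h
        by_cases c : a.val + 1 < k
        · have := g3 c; omega
        · omega
      · have := pinj _ (by omega) _ (by omega) h; omega
      · have := hpq _ (by omega) _ (by omega) h.symm; omega
    · exfalso
      rcases frange w with ⟨s, hs, e1⟩ | e1 | ⟨s, s0, hs, e1⟩ <;> rw [e1] at h
      · have := hpq _ (by omega) _ (by omega) h; omega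
      · have := hpq _ (by omega) _ (by omega) h; omega
      · have := qinj _ (by omega) _ (by omega) h; omega
  · intro a b c d hab hcd hne x hx hx'
    by_contra hxr
    rcases branch a b hab _ hx with h | h | h
    · exact hxr ⟨_, h.symm⟩
    · exact hxr ⟨_, h.symm⟩
    rcases branch c d hcd _ hx' with h' | h' | h'
    · exact hxr ⟨_, h'.symm⟩
    · exact hxr ⟨_, h'.symm⟩
    clear h h'
    have hal := a.isLt
    have hbl := b.isLt
    have hcl := c.isLt
    have hdl := d.isLt
    rcases adj a b hab with ⟨ha, hb, e1, e2, e3⟩ | ⟨ha, j, hj, hb, ha', e1, e2, e3⟩ <;>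
      rcases adj c d hcd with ⟨hc, hd, e1', e2', e3'⟩ | ⟨hc, j', hj', hd, hc', e1', e2', e3'⟩ <;>
      rw [e3] at hx <;> rw [e3'] at hx'
    · obtain ⟨g1, g2, g3, g4⟩ := ee _ ha
      obtain ⟨g1', g2', g3', g4'⟩ := ee _ hc
      obtain ⟨t, t1, t2, rfl⟩ := mem _ _ _ _ g1.le hx
      obtain ⟨t', t1', t2', ht⟩ := mem _ _ _ _ g1'.le hx'
      have htt := pinj _ (by omega) _ (by omega) ht
      have hac : a.val ≠ c.val := by
        intro hac
        exact hne (Prod.ext (Fin.ext hac) (Fin.ext (by simp only; omega)))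
      rcases lt_or_gt_of_ne hac with hlt | hlt
      · have := g3 (by omega)
        exact hxr ⟨c, by rw [e1']; congr 1; omega⟩
      · have := g3' (by omega)
        exact hxr ⟨a, by rw [e1]; congr 1; omega⟩
    · obtain ⟨g1, g2, g3, g4⟩ := ee _ ha
      obtain ⟨g1', g2', g3', g4'⟩ := ee' _ hj'
      obtain ⟨t, t1, t2, rfl⟩ := mem _ _ _ _ g1.le hx
      obtain ⟨t', t1', t2', ht⟩ := mem _ _ _ _ g1'.le hx'
      rcases hpq _ (by omega) _ (by omega) ht.symm with hh | hh
      · exact hxr ⟨⟨0, by omega⟩, by rw [fp _ (by simp; omega), hh.1]⟩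
      · exact hxr ⟨⟨k, by omega⟩, by rw [fk _ rfl, hh.1]⟩
    · obtain ⟨g1, g2, g3, g4⟩ := ee' _ hj
      obtain ⟨g1', g2', g3', g4'⟩ := ee _ hc
      obtain ⟨t, t1, t2, rfl⟩ := mem _ _ _ _ g1.le hx
      obtain ⟨t', t1', t2', ht⟩ := mem _ _ _ _ g1'.le hx'
      rcases hpq _ (by omega) _ (by omega) ht with hh | hh
      · exact hxr ⟨⟨0, by omega⟩, by rw [fp _ (by simp; omega), ← ht, hh.1]⟩
      · exact hxr ⟨⟨k, by omega⟩, by rw [fk _ rfl, ← ht, hh.1]⟩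
    · obtain ⟨g1, g2, g3, g4⟩ := ee' _ hj
      obtain ⟨g1', g2', g3', g4'⟩ := ee' _ hj'
      obtain ⟨t, t1, t2, rfl⟩ := mem _ _ _ _ g1.le hx
      obtain ⟨t', t1', t2', ht⟩ := mem _ _ _ _ g1'.le hx'
      have htt := qinj _ (by omega) _ (by omega) ht
      have hac : j ≠ j' := by
        intro hac
        have hbd : b = d := Fin.ext (by omega)
        exact hne (Prod.ext (Fin.ext (by rw [ha', hc', hbd])) hbd)
      rcases lt_or_gt_of_ne hac with hlt | hlt
      · have := g3 (by omega)
        exact hxr ⟨c, by rw [e1']; congr 1; omega⟩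
      · have := g3' (by omega)
        exact hxr ⟨a, by rw [e1]; congr 1; omega⟩

theorem noTwoBlocks_of_not_containsSubdivision {V : Type*} (D : Digraph V) {k l : ℕ}
    (hk : 2 ≤ k) (hl : 1 ≤ l) (h : ¬ ContainsSubdivision (twoBlockCycle k l) D) :
    NoTwoBlocks D.Adj k l := by
  rintro S T a b m n hab ⟨p, p0, p1, p2, p3, p4⟩ ⟨q, q0, q1, q2, q3, q4⟩ hST hm hn
  refine h (containsSubdivision_twoBlockCycle D hk hl p q hm hn p2 q2 p3 q3
    (p0.trans q0.symm) (p1.trans q1.symm) ?_)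
  intro i hi j hj hij
  rcases hST ⟨p4 i hi, hij ▸ q4 j hj⟩ with hx | hx
  · exact Or.inl ⟨p3 i hi 0 (by omega) (hx.trans p0.symm),
      q3 j hj 0 (by omega) ((hij.symm.trans hx).trans q0.symm)⟩
  · exact Or.inr ⟨p3 i hi m le_rfl (hx.trans p1.symm),
      q3 j hj n le_rfl ((hij.symm.trans hx).trans q1.symm)⟩

/-! ### Bondy's theorem via integer potentials -/

theorem exists_int_mul_of_tight {V : Type*} (x : V → ℤ) (f : V → V → ℤ) (k : ℤ) (p : ℕ → V)
    (n : ℕ) (h : ∀ i < n, x (p (i + 1)) - x (p i) = 1 - k * f (p i) (p (i + 1))) :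
    ∃ s : ℤ, x (p n) - x (p 0) = n - k * s := by
  induction n with
  | zero => exact ⟨0, by simp⟩
  | succ n ih =>
    obtain ⟨s, hs⟩ := ih fun i hi => h i (by omega)
    refine ⟨s + f (p n) (p (n + 1)), ?_⟩
    have := h n (by omega)
    push_cast
    linarith

theorem sub_le_of_feasible {V : Type*} (x : V → ℤ) (f : V → V → ℤ) (k : ℤ) (p : ℕ → V)
    (n : ℕ) (h : ∀ i < n, 1 - k * f (p i) (p (i + 1)) ≤ x (p (i + 1)) - x (p i)) :
    (n : ℤ) - k * ∑ i ∈ Finset.range n, f (p i) (p (i + 1)) ≤ x (p n) - x (p 0) := by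
  induction n with
  | zero => simp
  | succ n ih =>
    have h1 := ih fun i hi => h i (by omega)
    have := h n (by omega)
    rw [Finset.sum_range_succ]
    push_cast
    linarith

/-- Bondy's theorem: if all directed cycles of a finite strong digraph have length at most `k`,
then the digraph is `k`-colourable; the colours are the residues modulo `k` of `x`. -/
theorem exists_coloring_of_forall_cycle_length_le {V : Type*} [Finite V] (R : V → V → Prop)
    (hs : ∀ u v, Relation.ReflTransGen R u v) (k : ℕ) (hk : 1 ≤ k)
    (hc : ∀ u v n, u ≠ v → HasPath R Set.univ v u n → R u v → n + 1 ≤ k) :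
    ∃ x : V → ℤ, ∀ u v, u ≠ v → R u v → ¬ (k : ℤ) ∣ x v - x u := by
  classical
  have := Fintype.ofFinite V
  choose len hlen using fun u v : V => HasPath.of_reflTransGen (hs v u)
  choose p p0 p1 p2 p3 p4 using hlen
  -- The weights `f` relax the demand that `x` grow by at least one along each arc, in multiples of
  -- `k`. The proof lowers `f` until the residues of `x` are a proper colouring. The measure `μ`
  -- sums the `f`-weights of one closed walk through each arc. On a closed walk the increments of
  -- `x` cancel, so `k` times its weight is at least its length, and hence `μ` is bounded below.
  let Valid : (V → ℤ) → (V → V → ℤ) → Prop := fun x f =>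
    ∀ u v, R u v → 1 - k * f u v ≤ x v - x u
  let g : (V → V → ℤ) → V × V → ℤ := fun f e =>
    f e.1 e.2 + ∑ i ∈ Finset.range (len e.1 e.2), f (p e.1 e.2 i) (p e.1 e.2 (i + 1))
  let μ : (V → V → ℤ) → ℤ := fun f => ∑ e ∈ Finset.univ.filter fun e : V × V => R e.1 e.2, g f e
  have hμ : ∀ x f, Valid x f → 0 ≤ μ f := by
    intro x f hv
    refine Finset.sum_nonneg fun e he => ?_
    have he' := (Finset.mem_filter.1 he).2
    have h1 := hv _ _ he'
    have h2 := sub_le_of_feasible x f k (p e.1 e.2) (len e.1 e.2)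
      fun i hi => hv _ _ (p2 _ _ i hi)
    rw [p0, p1] at h2
    have h3 : (1 : ℤ) ≤ k * g f e := by
      simp only [g, mul_add]
      have : (0 : ℤ) ≤ len e.1 e.2 := by positivity
      linarith
    by_contra hneg
    push Not at hneg
    have : (k : ℤ) * g f e ≤ 0 := mul_nonpos_of_nonneg_of_nonpos (by positivity) hneg.le
    linarith
  have hdec : ∀ f u v, R u v → μ (fun a b => if a = u ∧ b = v then f a b - 1 else f a b) < μ f := by
    intro f u v huv
    have hle : ∀ a b, (if a = u ∧ b = v then f a b - 1 else f a b) ≤ f a b := by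
      intro a b; split_ifs <;> omega
    refine Finset.sum_lt_sum (fun e _ => ?_) ⟨(u, v), by simpa using huv, ?_⟩
    · exact add_le_add (hle _ _) (Finset.sum_le_sum fun i _ => hle _ _)
    · refine add_lt_add_of_lt_of_le ?_ (Finset.sum_le_sum fun i _ => hle _ _)
      simp
  have main : ∀ m : ℕ, ∀ x f, Valid x f → (μ f).toNat = m →
      ∃ x : V → ℤ, ∀ u v, u ≠ v → R u v → ¬ (k : ℤ) ∣ x v - x u := by
    intro m
    induction m using Nat.strong_induction_on with
    | _ m ih =>
    intro x f hv hm
    by_cases hgood : ∀ u v, u ≠ v → R u v → ¬ (k : ℤ) ∣ x v - x u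
    · exact ⟨x, hgood⟩
    push Not at hgood
    obtain ⟨u, v, huv, hr, q, hq⟩ := hgood
    -- On a badly coloured arc `uv` the weight can be lowered by one, possibly after changing `x`;
    -- this decreases `μ`.
    set f' : V → V → ℤ := fun a b => if a = u ∧ b = v then f a b - 1 else f a b with hf'
    suffices hx : ∃ x', Valid x' f' by
      obtain ⟨x', hx'⟩ := hx
      refine ih (μ f').toNat ?_ x' f' hx' rfl
      have := hμ x' f' hx'
      have : μ f' < μ f := hdec f u v hr
      omega
    by_cases h1 : 1 - k * (f u v - 1) ≤ x v - x u
    · refine ⟨x, fun a b hab => ?_⟩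
      by_cases hab' : a = u ∧ b = v
      · obtain ⟨rfl, rfl⟩ := hab'
        simpa [hf'] using h1
      · simpa [hf', hab'] using hv a b hab
    · have h2 := hv u v hr
      have hkp : (0 : ℤ) < k := by exact_mod_cast hk
      -- This is the only multiple of `k` in the interval from `1 - k * f u v` to `k - k * f u v`.
      have h3 : x v - x u = k * (1 - f u v) := by
        rw [hq]; congr 1
        rw [hq] at h1 h2
        have l1 : (k : ℤ) * q < k * (2 - f u v) := by linarith
        have l2 : (k : ℤ) * (- f u v) < k * q := by linarith
        have := lt_of_mul_lt_mul_left l1 hkp.le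
        have := lt_of_mul_lt_mul_left l2 hkp.le
        omega
      let T : V → V → Prop := fun a b => R a b ∧ x b - x a = 1 - k * f a b
      -- Along tight arcs `x` grows modulo `k` by the number of arcs. A tight path from `v` to `u`
      -- would thus have positive length `n` divisible by `k`, and together with `uv` would close a
      -- cycle of length `n + 1 > k`.
      have hu : ¬ Relation.ReflTransGen T v u := by
        intro hT
        obtain ⟨n, hp⟩ := HasPath.of_reflTransGen hT
        have hn := hp.pos_of_ne huv.symm
        have hnk := hc u v n huv (hp.mono (fun _ _ _ _ h => h.1) le_rfl) hr
        obtain ⟨r, r0, r1, r2, -, -⟩ := hp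
        obtain ⟨s, hs⟩ := exists_int_mul_of_tight x f k r n fun i hi => (r2 i hi).2
        rw [r0, r1] at hs
        have hd : (k : ℤ) ∣ n := ⟨s + f u v - 1, by linarith⟩
        have := Nat.le_of_dvd hn (Int.natCast_dvd_natCast.1 hd)
        omega
      -- Raising `x` by one on the vertices tightly reachable from `v` provides the one unit missing
      -- on `uv`. Arcs leaving this set are not tight, so they have a unit to spare.
      refine ⟨fun w => if Relation.ReflTransGen T v w then x w + 1 else x w, fun a b hab => ?_⟩
      have hvab := hv a b hab
      by_cases hab' : a = u ∧ b = v
      · obtain ⟨rfl, rfl⟩ := hab'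
        have : Relation.ReflTransGen T b b := Relation.ReflTransGen.refl
        simp only [hu, this, if_true, if_false, hf', and_self]
        linarith
      · simp only [hf', hab', if_false]
        by_cases ha : Relation.ReflTransGen T v a <;> by_cases hb : Relation.ReflTransGen T v b <;>
          simp only [ha, hb, if_true, if_false]
        · linarith
        · have : x b - x a ≠ 1 - k * f a b := fun h => hb (ha.tail ⟨hab, h⟩)
          omega
        · linarith
        · linarith
  refine main _ (fun _ => 0) (fun _ _ => 1) ?_ rfl
  intro u v _
  have : (1 : ℤ) ≤ k := by exact_mod_cast hk
  simp only
  linarith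

/-! ### Cycles of a quotient -/

/-- The pairs `(X i, Y i)`, `i < n`, describe a directed cycle of length `n` in the quotient of the
digraph `R` by the fibres of `π`: the cycle enters its `i`-th fibre at `X i`, leaves it at `Y i`,
and visits each fibre at most once. -/
structure IsQuotCycle {V α : Type*} (R : V → V → Prop) (π : V → α) (n : ℕ) (X Y : ℕ → V) :
    Prop where
  pos : 0 < n
  eq : ∀ i < n, π (X i) = π (Y i)
  adj : ∀ i, i + 1 < n → R (Y i) (X (i + 1))
  close : R (Y (n - 1)) (X 0)
  inj : ∀ i < n, ∀ j < n, π (X i) = π (X j) → i = j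

/-- Rotation by `s` of the indices below `n`. -/
def rotIndex (n s i : ℕ) : ℕ := if i + s < n then i + s else i + s - n

theorem exists_rotIndex_eq {n s j : ℕ} (hs : s < n) (hj : j < n) :
    ∃ i < n, rotIndex n s i = j := by
  by_cases h : s ≤ j
  · exact ⟨j - s, by omega, by unfold rotIndex; grind⟩
  · exact ⟨j + n - s, by omega, by unfold rotIndex; grind⟩

theorem rotIndex_lt {n s i : ℕ} (hs : s < n) (hi : i < n) : rotIndex n s i < n := by
  unfold rotIndex; split_ifs <;> omega

namespace IsQuotCycle

variable {V α : Type*} {R : V → V → Prop} {π : V → α} {n : ℕ} {X Y c : ℕ → V}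

theorem rotate (h : IsQuotCycle R π n X Y) {s : ℕ} (hs : s < n) :
    IsQuotCycle R π n (fun i => X (rotIndex n s i)) (fun i => Y (rotIndex n s i)) where
  pos := h.pos
  eq i hi := h.eq _ (rotIndex_lt hs hi)
  adj i hi := by
    by_cases h1 : i + 1 + s < n
    · have e1 : rotIndex n s i = i + s := by unfold rotIndex; grind
      have e2 : rotIndex n s (i + 1) = i + s + 1 := by unfold rotIndex; grind
      simp only [e1, e2]; exact h.adj _ (by omega)
    · by_cases h2 : i + 1 + s = n
      · have e1 : rotIndex n s i = n - 1 := by unfold rotIndex; grind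
        have e2 : rotIndex n s (i + 1) = 0 := by unfold rotIndex; grind
        simp only [e1, e2]; exact h.close
      · have e1 : rotIndex n s i = i + s - n := by unfold rotIndex; grind
        have e2 : rotIndex n s (i + 1) = i + s - n + 1 := by unfold rotIndex; grind
        simp only [e1, e2]; exact h.adj _ (by omega)
  close := by
    by_cases h0 : s = 0
    · have e1 : rotIndex n s (n - 1) = n - 1 := by unfold rotIndex; split_ifs <;> omega
      have e2 : rotIndex n s 0 = 0 := by unfold rotIndex; split_ifs <;> omega
      simp only [e1, e2]; exact h.close
    · have e1 : rotIndex n s (n - 1) = s - 1 := by unfold rotIndex; split_ifs <;> omega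
      have e2 : rotIndex n s 0 = s - 1 + 1 := by unfold rotIndex; split_ifs <;> omega
      simp only [e1, e2]; exact h.adj _ (by omega)
  inj i hi j hj hij := by
    have := h.inj _ (rotIndex_lt hs hi) _ (rotIndex_lt hs hj) hij
    unfold rotIndex at this; split_ifs at this <;> omega

theorem inj_id (h : IsQuotCycle R id n c c) {i j : ℕ} (hi : i < n) (hj : j < n)
    (hij : c i = c j) : i = j := h.inj i hi j hj hij

theorem hasPath (h : IsQuotCycle R id n c c) {a b : ℕ} (hab : a ≤ b) (hb : b < n) :
    HasPath R (c '' Set.Icc a b) (c a) (c b) (b - a) :=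
  HasPath.of_seq c hab (fun i _ hi => h.adj i (by omega))
    (fun _ _ _ hi _ hj hij => h.inj_id (by omega) (by omega) hij)

theorem hasPath_zero (h : IsQuotCycle R id n c c) {a : ℕ} (ha : 0 < a) (han : a < n) :
    HasPath R (c '' Set.Icc a (n - 1) ∪ {c 0}) (c a) (c 0) (n - a) := by
  have := (h.hasPath (a := a) (b := n - 1) (by omega) (by omega)).snoc h.close (by
    rintro ⟨x, ⟨h1, h2⟩, h3⟩
    have := h.inj_id (by omega) (by omega) h3
    omega)
  rwa [show n - 1 - a + 1 = n - a by omega] at this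

theorem exists_hasPath (h : IsQuotCycle R id n c c) {i j : ℕ} (hi : i < n) (hj : j < n)
    (hij : i ≠ j) : ∃ m m', HasPath R (c '' Set.Iio n) (c i) (c j) m ∧
      HasPath R (c '' Set.Iio n) (c j) (c i) m' ∧ m + m' = n := by
  have h' := h.rotate hi
  obtain ⟨d, hd, hdj⟩ := exists_rotIndex_eq hi hj
  have e0 : rotIndex n i 0 = i := by unfold rotIndex; split_ifs <;> omega
  have hd0 : 0 < d := by
    rcases Nat.eq_zero_or_pos d with rfl | h0
    · omega
    · exact h0
  have p1 := h'.hasPath (a := 0) (b := d) (by omega) hd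
  have p2 := h'.hasPath_zero hd0 hd
  simp only [e0, hdj] at p1 p2
  refine ⟨_, _, p1.mono_set ?_, p2.mono_set ?_, by omega⟩
  · rintro x ⟨y, ⟨-, hy⟩, rfl⟩
    exact ⟨_, rotIndex_lt hi (by omega), rfl⟩
  · rintro x (⟨y, ⟨-, hy⟩, rfl⟩ | rfl)
    · exact ⟨_, rotIndex_lt hi (by omega), rfl⟩
    · exact ⟨i, hi, rfl⟩

end IsQuotCycle

/-! ### Degeneracy on the vertex set of a directed cycle -/

/-- Two disjoint paths of lengths at least `k` and `l` whose initial vertices are adjacent and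
whose terminal vertices are adjacent contain a cycle with two blocks. -/
theorem NoTwoBlocks.false_of_disjoint {V : Type*} {R : V → V → Prop} {k l : ℕ}
    (h : NoTwoBlocks R k l) (hk : 1 ≤ k) (hl : 1 ≤ l) {S T : Set V} {a w b w' : V} {p m : ℕ}
    (hp : HasPath R S a w p) (hm : HasPath R T b w' m) (hST : ∀ x ∈ S, x ∉ T)
    (hab : R a b ∨ R b a) (hw : R w w' ∨ R w' w) (hkp : k ≤ p) (hlm : l ≤ m) : False := by
  have haS := hp.left_mem
  have hwS := hp.right_mem
  have hbT := hm.left_mem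
  have hwT := hm.right_mem
  have haT := hST _ haS
  have hw_T := hST _ hwS
  have hbS : b ∉ S := fun hx => hST _ hx hbT
  have hw_S : w' ∉ S := fun hx => hST _ hx hwT
  have haw : a ≠ w := by
    rintro rfl
    obtain ⟨r, r0, r1, -, r3, -⟩ := hp
    have := r3 0 (by omega) p le_rfl (r0.trans r1.symm)
    omega
  have hbw : b ≠ w' := by
    rintro rfl
    obtain ⟨r, r0, r1, -, r3, -⟩ := hm
    have := r3 0 (by omega) m le_rfl (r0.trans r1.symm)
    omega
  have haw' : a ≠ w' := fun e => hw_S (e ▸ haS)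
  have hbw' : b ≠ w := fun e => hbS (e ▸ hwS)
  -- Each connecting arc extends one of the two paths, chosen by its direction, so that both paths
  -- get common ends; lengths only grow.
  rcases hab with hab | hab <;> rcases hw with hw | hw
  · refine h _ _ a w' _ _ haw' (hp.snoc hw hw_S) (hm.cons hab haT) ?_ (by omega) (by omega)
    rintro x ⟨hx | hx, hx' | hx'⟩
    · exact Or.inl hx'
    · exact absurd hx' (hST x hx)
    · exact Or.inl hx'
    · exact Or.inr hx
  · refine h _ _ a w _ _ haw hp ((hm.cons hab haT).snoc hw ?_) ?_ (by omega) (by omega)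
    · rintro (hx | hx)
      · exact haw hx.symm
      · exact hw_T hx
    · rintro x ⟨hx, (hx' | hx') | hx'⟩
      · exact Or.inl hx'
      · exact absurd hx' (hST x hx)
      · exact Or.inr hx'
  · refine h _ _ b w' _ _ hbw ((hp.cons hab hbS).snoc hw ?_) hm ?_ (by omega) (by omega)
    · rintro (hx | hx)
      · exact hbw hx.symm
      · exact hw_S hx
    · rintro x ⟨(hx' | hx') | hx', hx⟩
      · exact Or.inl hx'
      · exact absurd hx (hST x hx')
      · exact Or.inr hx'
  · refine h _ _ b w _ _ hbw' (hp.cons hab hbS) (hm.snoc hw hw_T) ?_ (by omega) (by omega)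
    rintro x ⟨hx | hx, hx' | hx'⟩
    · exact Or.inl hx
    · exact Or.inl hx
    · exact absurd hx' (hST x hx)
    · exact Or.inr hx'

open Classical in
/-- On the vertex set of a directed cycle, a digraph without two-block cycles is
`(k + l)`-degenerate. -/
theorem NoTwoBlocks.exists_degree_le {V : Type*} {R : V → V → Prop} {k l : ℕ}
    (h : NoTwoBlocks R k l) (hk : 1 ≤ k) (hl : 1 ≤ l) {n : ℕ} {c : ℕ → V}
    (hc : IsQuotCycle R id n c c) (A : Finset V) (hA : A.Nonempty)
    (hAc : ∀ a ∈ A, ∃ i < n, c i = a) :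
    ∃ w ∈ A, (A.filter fun z => z ≠ w ∧ (R w z ∨ R z w)).card ≤ k + l := by
  by_contra! hdeg
  -- Among the adjacent pairs `c 0`, `c d`, over all admissible cyclic orderings, with at least `k`
  -- vertices of `A` strictly between them, one with `d` minimal is taken. The last vertex of `A`
  -- before `c d` will turn out to have small degree.
  let P : ℕ → Prop := fun d => ∃ c : ℕ → V, IsQuotCycle R id n c c ∧ (∀ a ∈ A, ∃ i < n, c i = a) ∧
    0 < d ∧ d < n ∧ (R (c 0) (c d) ∨ R (c d) (c 0)) ∧
    k ≤ ((Finset.Ioo 0 d).filter fun i => c i ∈ A).card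
  have rot : ∀ c : ℕ → V, IsQuotCycle R id n c c → (∀ a ∈ A, ∃ i < n, c i = a) → ∀ s < n,
      IsQuotCycle R id n (fun i => c (rotIndex n s i)) (fun i => c (rotIndex n s i)) ∧
      (∀ a ∈ A, ∃ i < n, c (rotIndex n s i) = a) := by
    intro c hc hAc s hs
    refine ⟨hc.rotate hs, fun a ha => ?_⟩
    obtain ⟨i, hi, rfl⟩ := hAc a ha
    obtain ⟨j, hj, hji⟩ := exists_rotIndex_eq hs hi
    exact ⟨j, hj, by rw [hji]⟩
  -- From any vertex of `A`, its farthest neighbour along the cycle works: the other neighbours in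
  -- `A` lie in between.
  have hP : ∃ d, P d := by
    obtain ⟨v, hv⟩ := hA
    obtain ⟨i, hi, hiv⟩ := hAc v hv
    obtain ⟨hc', hAc'⟩ := rot c hc hAc i hi
    have e0 : c (rotIndex n i 0) = v := by
      rw [← hiv]; congr 1; unfold rotIndex; split_ifs <;> omega
    obtain ⟨c', hc', hAc', e0⟩ : ∃ c' : ℕ → V, IsQuotCycle R id n c' c' ∧
        (∀ a ∈ A, ∃ i < n, c' i = a) ∧ c' 0 = v := ⟨_, hc', hAc', e0⟩
    have hd := hdeg v hv
    set J := (Finset.range n).filter fun j =>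
      c' j ∈ A ∧ c' j ≠ v ∧ (R v (c' j) ∨ R (c' j) v) with hJ
    have hsub : (A.filter fun z => z ≠ v ∧ (R v z ∨ R z v)) ⊆ J.image c' := by
      intro z hz
      rw [Finset.mem_filter] at hz
      obtain ⟨j, hj, rfl⟩ := hAc' z hz.1
      exact Finset.mem_image_of_mem _ (Finset.mem_filter.2 ⟨Finset.mem_range.2 hj, hz.1, hz.2⟩)
    have hcard := (Finset.card_le_card hsub).trans Finset.card_image_le
    have hne : J.Nonempty := Finset.card_pos.1 (by omega)
    have hm := J.max'_mem hne
    have hm' := (Finset.mem_filter.1 hm).2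
    refine ⟨J.max' hne, c', hc', hAc', ?_, ?_, ?_, ?_⟩
    · rcases Nat.eq_zero_or_pos (J.max' hne) with h0 | h0
      · rw [h0] at hm'; exact absurd e0 hm'.2.1
      · exact h0
    · exact Finset.mem_range.1 (Finset.mem_filter.1 hm).1
    · rw [e0]; exact hm'.2.2
    · have : J.erase (J.max' hne) ⊆
          (Finset.Ioo 0 (J.max' hne)).filter fun i => c' i ∈ A := by
        intro j hj
        obtain ⟨hj1, hj2⟩ := Finset.mem_erase.1 hj
        have hj3 := J.le_max' j hj2
        have hj4 := (Finset.mem_filter.1 hj2).2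
        refine Finset.mem_filter.2 ⟨Finset.mem_Ioo.2 ⟨?_, by omega⟩, hj4.1⟩
        rcases Nat.eq_zero_or_pos j with rfl | h0
        · exact absurd e0 hj4.2.1
        · exact h0
      have h1 := Finset.card_le_card this
      rw [Finset.card_erase_of_mem hm] at h1
      omega
  have hmin : ∀ d < Nat.find hP, ¬ P d := fun d hd => Nat.find_min hP hd
  obtain ⟨c, hc, hAc, hd0, hdn, hadj, hcard⟩ := Nat.find_spec hP
  generalize Nat.find hP = d at hmin hd0 hdn hadj hcard
  set I := (Finset.Ioo 0 d).filter fun i => c i ∈ A with hI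
  have hne : I.Nonempty := Finset.card_pos.1 (by omega)
  obtain ⟨p, hp⟩ : ∃ p, p = I.max' hne := ⟨_, rfl⟩
  have hpI : p ∈ I := hp ▸ I.max'_mem hne
  obtain ⟨hpd, hpA⟩ := Finset.mem_filter.1 hpI
  rw [Finset.mem_Ioo] at hpd
  have hkp : k ≤ p := by
    have : I ⊆ Finset.Ioc 0 p := by
      intro j hj
      have := I.le_max' j hj
      have := Finset.mem_Ioo.1 (Finset.mem_filter.1 hj).1
      exact Finset.mem_Ioc.2 ⟨this.1, by omega⟩
    have := Finset.card_le_card this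
    simp at this
    omega
  -- A neighbour of `c p` at distance `l` or more after `c d` would give the disjoint segments from
  -- `0` to `p` and from `d` to `q`, with adjacent starts and adjacent ends.
  have hout : ∀ q, d < q → q < n → (R (c p) (c q) ∨ R (c q) (c p)) → q < d + l := by
    intro q hdq hqn hr
    by_contra hlt
    refine h.false_of_disjoint hk hl (hc.hasPath (a := 0) (b := p) (by omega) (by omega))
      (hc.hasPath (a := d) (b := q) hdq.le hqn) ?_ hadj hr (by omega) (by omega)
    rintro x ⟨i, ⟨-, hi⟩, rfl⟩ ⟨j, ⟨hj, hj'⟩, hij⟩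
    have := hc.inj_id (by omega) (by omega) hij
    omega
  set L := (Finset.range p).filter fun i => c i ∈ A ∧ (R (c p) (c i) ∨ R (c i) (c p)) with hL
  -- With more than `k` neighbours before `p`, the first of them and `c p` would form a shorter pair
  -- with `k` vertices of `A` in between.
  have hLk : L.card ≤ k := by
    by_contra! hlt
    have hLne : L.Nonempty := Finset.card_pos.1 (by omega)
    obtain ⟨i, hi⟩ : ∃ i, i = L.min' hLne := ⟨_, rfl⟩
    have hiL : i ∈ L := hi ▸ L.min'_mem hLne
    have hiL' := Finset.mem_filter.1 hiL
    have hip := Finset.mem_range.1 hiL'.1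
    obtain ⟨hc', hAc'⟩ := rot c hc hAc i (by omega)
    have e : ∀ j, j + i < n → rotIndex n i j = j + i := by
      intro j hj; unfold rotIndex; split_ifs; rfl
    refine hmin (p - i) (by omega) ⟨_, hc', hAc', by omega, by omega, ?_, ?_⟩
    · rw [e 0 (by omega), e (p - i) (by omega), zero_add, Nat.sub_add_cancel hip.le]
      exact hiL'.2.2.symm
    · have : (L.erase i).card ≤
          ((Finset.Ioo 0 (p - i)).filter fun j => c (rotIndex n i j) ∈ A).card := by
        refine Finset.card_le_card_of_injOn (fun j => j - i) ?_ ?_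
        · intro j hj
          obtain ⟨hj1, hj2⟩ := Finset.mem_erase.1 hj
          have hj3 := L.min'_le j hj2
          obtain ⟨hj4, hj5, -⟩ := Finset.mem_filter.1 hj2
          rw [Finset.mem_range] at hj4
          simp only [Finset.coe_filter, Finset.mem_Ioo, Set.mem_ofPred_eq]
          rw [e _ (by omega), Nat.sub_add_cancel (by omega)]
          exact ⟨by omega, hj5⟩
        · intro j hj j' hj' hjj
          obtain ⟨-, hj2⟩ := Finset.mem_erase.1 hj
          obtain ⟨-, hj2'⟩ := Finset.mem_erase.1 hj'
          have hj3 := L.min'_le j hj2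
          have hj3' := L.min'_le j' hj2'
          simp only at hjj
          omega
      rw [Finset.card_erase_of_mem hiL] at this
      omega
  -- By the choice of `p`, no vertex of `A` lies strictly between `p` and `d`.
  have hsub : (A.filter fun z => z ≠ c p ∧ (R (c p) z ∨ R z (c p))) ⊆
      (L ∪ Finset.Ico d (d + l)).image c := by
    intro z hz
    obtain ⟨hzA, hzp, hzr⟩ := Finset.mem_filter.1 hz
    obtain ⟨q, hq, rfl⟩ := hAc z hzA
    refine Finset.mem_image_of_mem _ (Finset.mem_union.2 ?_)
    rcases lt_trichotomy q p with hqp | hqp | hqp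
    · exact Or.inl (Finset.mem_filter.2 ⟨Finset.mem_range.2 hqp, hzA, hzr⟩)
    · exact absurd (by rw [hqp]) hzp
    · refine Or.inr (Finset.mem_Ico.2 ?_)
      rcases lt_trichotomy q d with hqd | hqd | hqd
      · have := I.le_max' q (Finset.mem_filter.2 ⟨Finset.mem_Ioo.2 ⟨by omega, hqd⟩, hzA⟩)
        omega
      · omega
      · exact ⟨by omega, hout q hqd hq hzr⟩
  have h1 := (Finset.card_le_card hsub).trans
    (Finset.card_image_le.trans (Finset.card_union_le _ _))
  have h2 := hdeg _ hpA
  rw [Nat.card_Ico] at h1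
  omega

open Classical in
theorem exists_coloring_of_degenerate {V : Type*} (R : V → V → Prop) (d : ℕ) (B : Finset V)
    (h : ∀ A ⊆ B, A.Nonempty → ∃ w ∈ A,
      (A.filter fun z => z ≠ w ∧ (R w z ∨ R z w)).card ≤ d) :
    ∃ ψ : V → Fin (d + 1), ∀ u ∈ B, ∀ v ∈ B, u ≠ v → R u v → ψ u ≠ ψ v := by
  induction hn : B.card generalizing B with
  | zero =>
    rw [Finset.card_eq_zero] at hn
    exact ⟨fun _ => 0, by simp [hn]⟩
  | succ n ih =>
    obtain ⟨w, hw, hdeg⟩ := h B subset_rfl (Finset.card_pos.1 (by omega))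
    obtain ⟨ψ, hψ⟩ := ih (B.erase w) (fun A hA => h A (hA.trans (Finset.erase_subset _ _)))
      (by rw [Finset.card_erase_of_mem hw]; omega)
    obtain ⟨a, ha⟩ : ∃ a : Fin (d + 1),
        a ∉ (B.filter fun z => z ≠ w ∧ (R w z ∨ R z w)).image ψ := by
      by_contra! hall
      have := Finset.card_le_card (fun a _ => hall a : (Finset.univ : Finset (Fin (d + 1))) ⊆ _)
      have := this.trans Finset.card_image_le
      rw [Finset.card_univ, Fintype.card_fin] at this
      omega
    have ha' : ∀ z ∈ B, z ≠ w → (R w z ∨ R z w) → ψ z ≠ a := fun z hz hzw hr e =>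
      ha (Finset.mem_image.2 ⟨z, Finset.mem_filter.2 ⟨hz, hzw, hr⟩, e⟩)
    refine ⟨Function.update ψ w a, fun u hu v hv huv hr => ?_⟩
    by_cases h1 : u = w
    · subst h1
      rw [Function.update_self, Function.update_of_ne huv.symm]
      exact (ha' v hv huv.symm (Or.inl hr)).symm
    · by_cases h2 : v = w
      · subst h2
        rw [Function.update_self, Function.update_of_ne h1]
        exact ha' u hu h1 (Or.inr hr)
      · rw [Function.update_of_ne h1, Function.update_of_ne h2]
        exact hψ u (Finset.mem_erase.2 ⟨h1, hu⟩) v (Finset.mem_erase.2 ⟨h2, hv⟩) huv hr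

theorem NoTwoBlocks.exists_coloring_cycle {V : Type*} {R : V → V → Prop} {k l : ℕ}
    (h : NoTwoBlocks R k l) (hk : 1 ≤ k) (hl : 1 ≤ l) {n : ℕ} {c : ℕ → V}
    (hc : IsQuotCycle R id n c c) :
    ∃ ψ : V → Fin (k + l + 1), ∀ i < n, ∀ j < n, c i ≠ c j → R (c i) (c j) →
      ψ (c i) ≠ ψ (c j) := by
  classical
  obtain ⟨ψ, hψ⟩ := exists_coloring_of_degenerate R (k + l) ((Finset.range n).image c)
    fun A hA hne => h.exists_degree_le hk hl hc A hne fun a ha => by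
      obtain ⟨i, hi, hia⟩ := Finset.mem_image.1 (hA ha)
      exact ⟨i, Finset.mem_range.1 hi, hia⟩
  exact ⟨ψ, fun i hi j hj => hψ _ (Finset.mem_image_of_mem _ (Finset.mem_range.2 hi)) _
    (Finset.mem_image_of_mem _ (Finset.mem_range.2 hj))⟩

/-! ### Cyclic potentials -/

/-- The arcs of `R` along which the potential `φ` increases by one or two. -/
def PotentialArc {V : Type*} {M : ℕ} (R : V → V → Prop) (φ : V → ZMod M) (u v : V) : Prop :=
  R u v ∧ (φ v = φ u + 1 ∨ φ v = φ u + 2)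

theorem HasPath.exists_potential_eq {V : Type*} {M : ℕ} {R : V → V → Prop} {φ : V → ZMod M}
    {S : Set V} {u v : V} {n : ℕ} (h : HasPath (PotentialArc R φ) S u v n) :
    ∃ j : ℕ, n ≤ j ∧ j ≤ 2 * n ∧ φ v = φ u + j := by
  obtain ⟨p, rfl, rfl, p2, -, -⟩ := h
  clear S
  induction n with
  | zero => exact ⟨0, by simp⟩
  | succ n ih =>
    obtain ⟨j, h1, h2, h3⟩ := ih fun i hi => p2 i (by omega)
    rcases (p2 n (by omega)).2 with h4 | h4
    · exact ⟨j + 1, by omega, by omega, by rw [h4, h3]; push_cast; ring⟩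
    · exact ⟨j + 2, by omega, by omega, by rw [h4, h3]; push_cast; ring⟩

/-- The total increase lies between `n` and `2 * n`, hence strictly between `0` and `M`. -/
theorem HasPath.potential_ne {V : Type*} {M : ℕ} {R : V → V → Prop} {φ : V → ZMod M}
    {S : Set V} {u v : V} {n : ℕ} (h : HasPath (PotentialArc R φ) S u v n) (hn : 0 < n)
    (hM : 2 * n < M) : φ u ≠ φ v := by
  obtain ⟨j, h1, h2, h3⟩ := h.exists_potential_eq
  intro e
  rw [e] at h3
  have h4 : ((j : ℕ) : ZMod M) = 0 := by simpa using h3.symm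
  rw [ZMod.natCast_eq_zero_iff] at h4
  have := Nat.le_of_dvd (by omega) h4
  omega

/-- If `u` and `v` are adjacent and separated by `c` in a union of long cycles along which the
potential increases, then their potentials are different. -/
theorem NoTwoBlocks.potential_ne {V : Type*} {M : ℕ} {R : V → V → Prop} {φ : V → ZMod M}
    {k l N : ℕ} (h : NoTwoBlocks R k l) (hlk : l ≤ k)
    (hN : 2 * k ≤ N + 2) (hM : 4 * l < M + 4) {S T : Set V} {u v c : V} {a a' b b' : ℕ}
    (ha : HasPath (PotentialArc R φ) S c u a) (ha' : HasPath (PotentialArc R φ) S u c a')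
    (hb : HasPath (PotentialArc R φ) T c v b) (hb' : HasPath (PotentialArc R φ) T v c b')
    (hST : S ∩ T ⊆ {c}) (hu : u ≠ c) (hv : v ≠ c) (haN : N ≤ a + a') (hbN : N ≤ b + b')
    (huv : R u v) : φ u ≠ φ v := by
  have huS := ha.right_mem
  have hvT := hb.right_mem
  have hvS : v ∉ S := fun hx => hv (hST ⟨hx, hvT⟩)
  have huT : u ∉ T := fun hx => hu (hST ⟨huS, hx⟩)
  have toR : ∀ {S u v n}, HasPath (PotentialArc R φ) S u v n → HasPath R S u v n :=
    fun h => h.mono (fun _ _ _ _ h => h.1) le_rfl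
  have h1 := (toR ha).snoc huv hvS
  have h2 := (toR hb').cons huv huT
  have i1 : (S ∪ {v}) ∩ T ⊆ {c, v} := by
    rintro x ⟨hx | hx, hx'⟩
    · exact Or.inl (hST ⟨hx, hx'⟩)
    · exact Or.inr hx
  have i2 : S ∩ ({u} ∪ T) ⊆ {u, c} := by
    rintro x ⟨hx, hx' | hx'⟩
    · exact Or.inl hx'
    · exact Or.inr (hST ⟨hx, hx'⟩)
  -- The dipaths from `c` to `v`, directly or through `u`, and those from `u` to `c`, directly or
  -- through `v`, are two candidate pairs of blocks; each pair is excluded with either path as the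
  -- block of length `k`.
  have c1 : ¬ (k ≤ a + 1 ∧ l ≤ b) := fun ⟨x, y⟩ => h _ _ _ _ _ _ hv.symm h1 (toR hb) i1 x y
  have c2 : ¬ (k ≤ b ∧ l ≤ a + 1) := fun ⟨x, y⟩ =>
    h _ _ _ _ _ _ hv.symm (toR hb) h1 (by rwa [Set.inter_comm]) x y
  have c3 : ¬ (k ≤ a' ∧ l ≤ b' + 1) := fun ⟨x, y⟩ => h _ _ _ _ _ _ hu (toR ha') h2 i2 x y
  have c4 : ¬ (k ≤ b' + 1 ∧ l ≤ a') := fun ⟨x, y⟩ =>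
    h _ _ _ _ _ _ hu h2 (toR ha') (by rwa [Set.inter_comm]) x y
  have p1 := ha.pos_of_ne hu.symm
  have p2 := ha'.pos_of_ne hu
  -- If `a + 1 ≥ k`, then `b < l`, so `b' + 1 ≥ k` because `b + b' ≥ 2k - 2`, and therefore `a' <
  -- l`. Otherwise `a' ≥ k`, which bounds `b'` and then `a` in the same way.
  have hcases : a' + b + 2 ≤ 2 * l ∨ b' + a + 2 ≤ 2 * l := by omega
  rcases hcases with hc | hc
  · exact (ha'.concat hb hST).potential_ne (by omega) (by omega)
  · exact ((hb'.concat ha (by rwa [Set.inter_comm])).potential_ne (by omega) (by omega)).symm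

/-- Some multiple `n + e` of `M` lies between `n` and `2 * n`. Taking `e` of the `n` steps equal to
two and the others equal to one closes the potential up modulo `M`; allowing steps of two is what
makes every long cycle length admissible. -/
theorem exists_cyclic_potential {M n : ℕ} (hM : 1 ≤ M) (hn : 0 < n) (hMn : M ≤ n + 1) :
    ∃ r : ℕ → ZMod M, (∀ i, r (i + 1) = r i + 1 ∨ r (i + 1) = r i + 2) ∧
      (r 0 = r (n - 1) + 1 ∨ r 0 = r (n - 1) + 2) := by
  obtain ⟨e, q, he, heq⟩ : ∃ e q : ℕ, e ≤ n ∧ n + e = M * q := by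
    have h1 := Nat.div_add_mod n M
    have h2 := Nat.mod_lt n (show M > 0 by omega)
    refine ⟨M - n % M, n / M + 1, ?_, by rw [mul_add]; omega⟩
    by_contra hlt
    have h3 : n % M = 0 := by omega
    have := Nat.le_of_dvd hn (Nat.dvd_of_mod_eq_zero h3)
    omega
  have hz : ((n + e : ℕ) : ZMod M) = 0 := by rw [heq]; simp
  refine ⟨fun i => ((i + min i e : ℕ) : ZMod M), fun i => ?_, ?_⟩
  · simp only
    by_cases hi : i < e
    · right
      rw [min_eq_left hi.le, min_eq_left (show i + 1 ≤ e by omega)]; push_cast; ring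
    · left
      rw [min_eq_right (show e ≤ i by omega), min_eq_right (show e ≤ i + 1 by omega)]
      push_cast; ring
  · simp only
    by_cases hi : e = n
    · right
      rw [min_eq_left (show n - 1 ≤ e by omega)]
      have : ((n - 1 + (n - 1) + 2 : ℕ) : ZMod M) = 0 := by
        rw [← hz]; congr 1; omega
      push_cast at this
      simpa using this.symm
    · left
      rw [min_eq_right (show e ≤ n - 1 by omega)]
      have : ((n - 1 + e + 1 : ℕ) : ZMod M) = 0 := by
        rw [← hz]; congr 1; omega
      push_cast at this
      simpa using this.symm

/-! ### Merging the fibres of a longest quotient cycle -/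

theorem IsQuotCycle.to_id {V α : Type*} {R : V → V → Prop} {π : V → α} {n : ℕ} {c : ℕ → V}
    (h : IsQuotCycle R π n c c) : IsQuotCycle R id n c c :=
  ⟨h.pos, fun _ _ => rfl, h.adj, h.close, fun i hi j hj hij => h.inj i hi j hj (congrArg π hij)⟩

open Classical in
/-- The partition map obtained from `π` by merging the fibres of `c i`, `i < n`. -/
noncomputable def mergeFibres {V α : Type*} (π : V → α) (n : ℕ) (c : ℕ → V) (v : V) : α :=
  if ∃ i < n, π v = π (c i) then π (c 0) else π v

section mergeFibres

variable {V α : Type*} {R : V → V → Prop} {π : V → α} {n t b : ℕ} {c X Y : ℕ → V} {u v : V}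

theorem mergeFibres_of_mem (h : ∃ i < n, π v = π (c i)) : mergeFibres π n c v = π (c 0) :=
  if_pos h

theorem mergeFibres_of_notMem (h : ¬ ∃ i < n, π v = π (c i)) : mergeFibres π n c v = π v :=
  if_neg h

theorem mergeFibres_congr (h : π u = π v) : mergeFibres π n c u = mergeFibres π n c v := by
  unfold mergeFibres; rw [h]

theorem mergeFibres_eq_iff (hn : 0 < n) : mergeFibres π n c v = π (c 0) ↔
    ∃ i < n, π v = π (c i) := by
  constructor
  · intro h
    by_contra hv
    rw [mergeFibres_of_notMem hv] at h
    exact hv ⟨0, hn, h⟩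
  · exact mergeFibres_of_mem

theorem mem_of_mergeFibres_eq (hn : 0 < n) (h : mergeFibres π n c u = mergeFibres π n c v)
    (hne : π u ≠ π v) : (∃ i < n, π u = π (c i)) ∧ ∃ i < n, π v = π (c i) := by
  by_cases hu : ∃ i < n, π u = π (c i)
  · exact ⟨hu, (mergeFibres_eq_iff hn).1 (h ▸ mergeFibres_of_mem hu)⟩
  · by_cases hv : ∃ i < n, π v = π (c i)
    · exact absurd ((mergeFibres_eq_iff hn).1 (h.trans (mergeFibres_of_mem hv))) hu
    · rw [mergeFibres_of_notMem hu, mergeFibres_of_notMem hv] at h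
      exact absurd h hne

/-- A cycle of the merged quotient is expanded to a cycle of the original one by a segment of
the merged cycle. -/
theorem IsQuotCycle.expand (hc : IsQuotCycle R π n c c) (ht : 0 < t) (hb : 0 < b) (hbn : b < n)
    (hX : π (X 0) = π (c 0)) (hY : π (Y 0) = π (c b))
    (hXY : ∀ i < t, 0 < i → π (X i) = π (Y i))
    (hadj : ∀ i, i + 1 < t → R (Y i) (X (i + 1))) (hclose : R (Y (t - 1)) (X 0))
    (hinj : ∀ i < t, ∀ j < t, 0 < i → 0 < j → π (X i) = π (X j) → i = j)
    (hout : ∀ i < t, 0 < i → ∀ j < n, π (X i) ≠ π (c j)) :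
    IsQuotCycle R π (t + b) (fun i => if i = 0 then X 0 else if i ≤ b then c i else X (i - b))
      (fun i => if i < b then c i else Y (i - b)) := by
  have hπ : ∀ i, π (if i = 0 then X 0 else if i ≤ b then c i else X (i - b)) =
      if i ≤ b then π (c i) else π (X (i - b)) := by
    intro i
    by_cases h0 : i = 0
    · subst h0; simpa using hX
    · by_cases h1 : i ≤ b <;> simp [h0, h1]
  refine ⟨by omega, ?_, ?_, ?_, ?_⟩
  · intro i hi
    rw [hπ]
    rcases lt_trichotomy i b with h | h | h
    · simp [h, h.le]
    · subst h; simpa using hY.symm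
    · have h1 : ¬ i ≤ b := by omega
      have h2 : ¬ i < b := by omega
      simp only [h1, h2, if_false]
      exact hXY _ (by omega) (by omega)
  · intro i hi
    have h0 : i + 1 ≠ 0 := by omega
    by_cases h : i < b
    · have h1 : i + 1 ≤ b := h
      simp only [h, h0, h1, if_true, if_false]
      exact hc.adj i (by omega)
    · have h1 : ¬ i + 1 ≤ b := by omega
      simp only [h, h0, h1, if_false]
      rw [show i + 1 - b = i - b + 1 by omega]
      exact hadj _ (by omega)
  · have h1 : ¬ t + b - 1 < b := by omega
    simp only [h1, if_true, if_false]
    rw [show t + b - 1 - b = t - 1 by omega]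
    exact hclose
  · intro i hi j hj hij
    rw [hπ, hπ] at hij
    by_cases h1 : i ≤ b <;> by_cases h2 : j ≤ b <;> simp only [h1, h2, if_true, if_false] at hij
    · exact hc.inj i (by omega) j (by omega) hij
    · exact absurd hij.symm (hout _ (by omega) (by omega) _ (by omega))
    · exact absurd hij (hout _ (by omega) (by omega) _ (by omega))
    · have := hinj _ (by omega) _ (by omega) (by omega) (by omega) hij
      omega

/-- If all long cycles of a quotient enter and leave every fibre at the same vertex, then this
persists after merging the fibres of a longest cycle. -/
theorem NoTwoBlocks.closed_mergeFibres {k l N : ℕ} (h : NoTwoBlocks R k l)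
    (hkN : k ≤ N) (hlN : l ≤ N)
    (hclosed : ∀ m X Y, N ≤ m → IsQuotCycle R π m X Y → ∀ i < m, X i = Y i)
    (hc : IsQuotCycle R π n c c) (hmax : ∀ m X Y, IsQuotCycle R π m X Y → m ≤ n)
    (hNt : N ≤ t) (hZ : IsQuotCycle R (mergeFibres π n c) t X Y) : ∀ i < t, X i = Y i := by
  by_cases hall : ∀ i < t, π (X i) = π (Y i)
  · exact hclosed t X Y hNt ⟨hZ.pos, hall, hZ.adj, hZ.close,
      fun i hi j hj hij => hZ.inj i hi j hj (mergeFibres_congr hij)⟩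
  exfalso
  push Not at hall
  obtain ⟨s, hs, hne⟩ := hall
  have e0 : ∀ {n s}, s < n → rotIndex n s 0 = s := by
    intro n s hs; unfold rotIndex; split_ifs <;> omega
  rw [← e0 hs] at hne
  obtain ⟨X', Y', hZ', hne⟩ : ∃ X' Y', IsQuotCycle R (mergeFibres π n c) t X' Y' ∧
      π (X' 0) ≠ π (Y' 0) := ⟨_, _, hZ.rotate hs, hne⟩
  clear hZ
  obtain ⟨⟨a, ha, haX⟩, ⟨b, hb, hbY⟩⟩ := mem_of_mergeFibres_eq hc.pos (hZ'.eq 0 hZ'.pos) hne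
  have hX0 : mergeFibres π n c (X' 0) = π (c 0) := mergeFibres_of_mem ⟨a, ha, haX⟩
  -- After rotation the merged fibre is the one at index `0`, and the cycle visits it only once.
  have hXout : ∀ i < t, 0 < i → ¬ ∃ j < n, π (X' i) = π (c j) := by
    intro i hi hi0 hj
    have := hZ'.inj i hi 0 hZ'.pos ((mergeFibres_of_mem hj).trans hX0.symm)
    omega
  have hXY : ∀ i < t, 0 < i → π (X' i) = π (Y' i) := by
    intro i hi hi0
    by_contra hne'
    exact hXout i hi hi0 (mem_of_mergeFibres_eq hc.pos (hZ'.eq i hi) hne').1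
  obtain ⟨b', hb', hbb⟩ := exists_rotIndex_eq ha hb
  have hc' := hc.rotate ha
  have hb0 : 0 < b' := by
    rcases Nat.eq_zero_or_pos b' with rfl | h0
    · rw [e0 ha] at hbb
      exact absurd (by rw [haX, hbY, hbb]) hne
    · exact h0
  rw [← e0 ha] at haX
  rw [← hbb] at hbY
  have hXout' : ∀ i < t, 0 < i → ∀ j < n, π (X' i) ≠ π (c (rotIndex n a j)) :=
    fun i hi hi0 j hj e => hXout i hi hi0 ⟨_, rotIndex_lt ha hj, e⟩
  obtain ⟨d, hd, haX, hbY, hXout'⟩ : ∃ d : ℕ → V, IsQuotCycle R π n d d ∧ π (X' 0) = π (d 0) ∧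
      π (Y' 0) = π (d b') ∧ ∀ i < t, 0 < i → ∀ j < n, π (X' i) ≠ π (d j) :=
    ⟨_, hc', haX, hbY, hXout'⟩
  have hE := hd.expand hZ'.pos hb0 hb' haX hbY hXY hZ'.adj hZ'.close
    (fun i hi j hj _ _ hij => hZ'.inj i hi j hj (mergeFibres_congr hij)) hXout'
  -- The expanded cycle has length `t + b'`, so maximality of `n` leaves a segment of `d` from `d
  -- b'` back to `d 0` with `n - b' ≥ t ≥ N` arcs. Closedness of the expanded cycle turns the rest
  -- of it into a second dipath between the same vertices, with `t` arcs.
  have hlen := hmax _ _ _ hE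
  have heq := hclosed _ _ _ (by omega) hE
  have hX0 : X' 0 = d 0 := by simpa [hb0] using heq 0 (by omega)
  have hY0 : d b' = Y' 0 := by simpa [hb0.ne'] using heq b' (by omega)
  have hXY' : ∀ i < t, 0 < i → X' i = Y' i := by
    intro i hi hi0
    have := heq (i + b') (by omega)
    have h1 : ¬ i + b' ≤ b' := by omega
    have h2 : ¬ i + b' < b' := by omega
    have h3 : i + b' ≠ 0 := by omega
    simpa only [h1, h2, h3, if_false, Nat.add_sub_cancel] using this
  have hd' := hd.to_id
  -- This is the dipath from `d b'` to `d 0` outside the merged fibre.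
  let r : ℕ → V := fun i => if i = 0 then d b' else if i < t then X' i else d 0
  have ht := hZ'.pos
  have hrmem : ∀ i, 0 < i → i < t → r i = X' i := by
    intro i h1 h2
    simp [r, h1.ne', h2]
  have hr0 : r 0 = d b' := by simp [r]
  have hrt : r t = d 0 := by simp [r, ht.ne']
  have hp2 : HasPath R (r '' Set.Icc 0 t) (r 0) (r t) (t - 0) := by
    refine HasPath.of_seq r (by omega) ?_ ?_
    · intro i _ hi
      have hs : R (Y' i) (r (i + 1)) := by
        by_cases h1 : i + 1 < t
        · rw [hrmem _ (by omega) h1]; exact hZ'.adj i h1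
        · have : i + 1 = t := by omega
          rw [this, hrt, ← hX0, show i = t - 1 by omega]
          exact hZ'.close
      rcases Nat.eq_zero_or_pos i with rfl | h0
      · rwa [hr0, hY0]
      · rwa [hrmem i h0 hi, hXY' i hi h0]
    · have key : ∀ i ≤ t, (i = 0 ∧ r i = d b') ∨ (i = t ∧ r i = d 0) ∨
          (0 < i ∧ i < t ∧ r i = X' i) := by
        intro i hi
        rcases Nat.eq_zero_or_pos i with rfl | h0
        · exact Or.inl ⟨rfl, hr0⟩
        · rcases hi.lt_or_eq with h1 | rfl
          · exact Or.inr (Or.inr ⟨h0, h1, hrmem i h0 h1⟩)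
          · exact Or.inr (Or.inl ⟨rfl, hrt⟩)
      have hdne : d b' ≠ d 0 := fun e => hb0.ne' (hd'.inj_id hb' (by omega) e)
      intro i j _ hi _ hj hij
      rcases key i hi with ⟨h1, e1⟩ | ⟨h1, e1⟩ | ⟨h1, h1', e1⟩ <;>
        rcases key j hj with ⟨h2, e2⟩ | ⟨h2, e2⟩ | ⟨h2, h2', e2⟩ <;> rw [e1, e2] at hij
      · omega
      · exact absurd hij hdne
      · exact absurd (congrArg π hij.symm) (hXout' j h2' h2 _ hb')
      · exact absurd hij.symm hdne
      · omega
      · exact absurd (congrArg π hij.symm) (hXout' j h2' h2 _ hd.pos)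
      · exact absurd (congrArg π hij) (hXout' i h1' h1 _ hb')
      · exact absurd (congrArg π hij) (hXout' i h1' h1 _ hd.pos)
      · exact hZ'.inj i h1' j h2' (by rw [hij])
  have hp1 := hd'.hasPath_zero hb0 hb'
  rw [hr0, hrt] at hp2
  refine h _ _ _ _ _ _ ?_ hp1 hp2 ?_ (by omega) (by omega)
  · exact fun e => hb0.ne' (hd'.inj_id hb' hd.pos e)
  · rintro x ⟨hx, ⟨i, ⟨-, hi⟩, rfl⟩⟩
    obtain ⟨j, hj, hjx⟩ : ∃ j < n, r i = d j := by
      rcases hx with ⟨j, ⟨-, hj⟩, hjx⟩ | hx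
      · have := hd.pos
        exact ⟨j, by omega, hjx.symm⟩
      · exact ⟨0, hd.pos, hx⟩
    rcases Nat.eq_zero_or_pos i with rfl | h0
    · exact Or.inl hr0
    · rcases hi.lt_or_eq with h1 | rfl
      · rw [hrmem i h0 h1] at hjx
        exact absurd (congrArg π hjx) (hXout' i h1 h0 j hj)
      · exact Or.inr hrt

end mergeFibres

/-! ### Cactus partitions and their labels -/

/-- The fibres of `π` are spanned by long cycles arranged in a tree-like manner: `φ` is a potential
along these cycles, and `φ` and `ψ` together colour the digraph inside each fibre. -/
structure IsCactusPartition {V α β : Type*} {M : ℕ} (R : V → V → Prop) (N : ℕ) (π : V → α)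
    (φ : V → ZMod M) (ψ : V → β) : Prop where
  paths : ∀ u w, u ≠ w → π u = π w → ∃ m m',
    HasPath (PotentialArc R φ) {x | π x = π u} u w m ∧
    HasPath (PotentialArc R φ) {x | π x = π u} w u m' ∧ N ≤ m + m'
  colour : ∀ u v, π u = π v → R u v → u = v ∨ φ u ≠ φ v ∨ ψ u ≠ ψ v
  closed : ∀ n X Y, N ≤ n → IsQuotCycle R π n X Y → ∀ i < n, X i = Y i

theorem IsCactusPartition.discrete {V β : Type*} {M : ℕ} (R : V → V → Prop) (N : ℕ)
    (φ : V → ZMod M) (ψ : V → β) : IsCactusPartition R N id φ ψ where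
  paths _ _ hne he := absurd he hne
  colour _ _ he _ := Or.inl he
  closed _ _ _ _ h i hi := h.eq i hi

/-- The labels of `φ` and `ψ` may be changed by a translation and a permutation on each fibre. -/
theorem IsCactusPartition.relabel {V α β : Type*} {M : ℕ} {R : V → V → Prop} {N : ℕ} {π : V → α}
    {φ : V → ZMod M} {ψ : V → β} (h : IsCactusPartition R N π φ ψ) (s : V → ZMod M)
    (σ : V → Equiv.Perm β) (hs : ∀ u v, π u = π v → s u = s v)
    (hσ : ∀ u v, π u = π v → σ u = σ v) :
    IsCactusPartition R N π (fun v => φ v + s v) (fun v => σ v (ψ v)) where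
  paths u w hne he := by
    obtain ⟨m, m', h1, h2, h3⟩ := h.paths u w hne he
    have key : ∀ a ∈ {x | π x = π u}, ∀ b ∈ {x | π x = π u}, PotentialArc R φ a b →
        PotentialArc R (fun v => φ v + s v) a b := by
      rintro a ha b hb ⟨hr, hab⟩
      have e : s a = s b := hs a b (Eq.trans ha (Eq.symm hb))
      refine ⟨hr, hab.imp ?_ ?_⟩ <;> intro h <;> simp only [h, e] <;> ring
    exact ⟨m, m', h1.mono key le_rfl, h2.mono key le_rfl, h3⟩
  colour u v he hr := by
    rcases h.colour u v he hr with h1 | h1 | h1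
    · exact Or.inl h1
    · exact Or.inr (Or.inl (by simpa [hs u v he] using h1))
    · exact Or.inr (Or.inr (by simpa [hσ u v he] using h1))
  closed := h.closed

/-- Merging the fibres of a longest cycle on which the labels are compatible. -/
theorem IsCactusPartition.merge {V α β : Type*} {M : ℕ} {R : V → V → Prop} {N k l : ℕ} {π : V → α}
    {φ : V → ZMod M} {ψ : V → β} (h : IsCactusPartition R N π φ ψ) (hR : NoTwoBlocks R k l)
    (hlk : l ≤ k) (hkN : k ≤ N) (hN : 2 * k ≤ N + 2) (hM : 4 * l < M + 4)
    {n : ℕ} {c : ℕ → V} (hc : IsQuotCycle R π n c c) (hNn : N ≤ n)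
    (hmax : ∀ m X Y, IsQuotCycle R π m X Y → m ≤ n)
    (hφ : IsQuotCycle (PotentialArc R φ) id n c c)
    (hψ : ∀ i < n, ∀ j < n, c i ≠ c j → R (c i) (c j) → ψ (c i) ≠ ψ (c j)) :
    IsCactusPartition R N (mergeFibres π n c) φ ψ := by
  set π' := mergeFibres π n c with hπ'
  have hmono : ∀ v, {x | π x = π v} ⊆ {x | π' x = π' v} := fun v x hx => mergeFibres_congr hx
  have hcmem : ∀ i < n, π' (c i) = π (c 0) := fun i hi => mergeFibres_of_mem ⟨i, hi, rfl⟩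
  have hcsub : c '' Set.Iio n ⊆ {x | π' x = π (c 0)} := by
    rintro x ⟨i, hi, rfl⟩; exact hcmem i hi
  -- Inside its old fibre, `v` is joined in both directions to the unique cycle vertex of that
  -- fibre.
  have attach : ∀ v i, π v = π (c i) → ∃ m m',
      HasPath (PotentialArc R φ) {x | π x = π v} v (c i) m ∧
      HasPath (PotentialArc R φ) {x | π x = π v} (c i) v m' ∧ (v ≠ c i → N ≤ m + m') := by
    intro v i hv
    by_cases hvc : v = c i
    · exact ⟨0, 0, hvc ▸ HasPath.refl rfl, hvc ▸ HasPath.refl rfl, fun hne => absurd hvc hne⟩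
    · obtain ⟨m, m', h1, h2, h3⟩ := h.paths v (c i) hvc hv
      exact ⟨m, m', h1, h2, fun _ => h3⟩
  have hCv : ∀ v j, j < n → π v = π (c j) → c '' Set.Iio n ∩ {x | π x = π v} ⊆ {c j} := by
    rintro v j hj hv x ⟨⟨i, hi, rfl⟩, hx⟩
    have := hc.inj i hi j hj (Eq.trans hx hv)
    rw [this]; rfl
  -- The dipaths in the fibre of `v` are continued around the cycle to another `c i`; the two parts
  -- of the cycle alone already have total length `n ≥ N`.
  have reach : ∀ v i j, i < n → j < n → i ≠ j → π v = π (c j) → ∃ b b',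
      HasPath (PotentialArc R φ) (c '' Set.Iio n ∪ {x | π x = π v}) (c i) v b ∧
      HasPath (PotentialArc R φ) (c '' Set.Iio n ∪ {x | π x = π v}) v (c i) b' ∧ N ≤ b + b' := by
    intro v i j hi hj hij hv
    obtain ⟨m, m', h1, h2, -⟩ := attach v j hv
    obtain ⟨a, a', g1, g2, g3⟩ := hφ.exists_hasPath hi hj hij
    refine ⟨_, m + a', g1.concat h2 (hCv v j hj hv), ?_, by omega⟩
    rw [Set.union_comm]
    exact h1.concat g2 (by rw [Set.inter_comm]; exact hCv v j hj hv)
  -- The vertex `c i` separates its old fibre from the cycle together with any other old fibre.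
  have hsep : ∀ u v i j, i < n → j < n → i ≠ j → π u = π (c i) → π v = π (c j) →
      {x | π x = π u} ∩ (c '' Set.Iio n ∪ {x | π x = π v}) ⊆ {c i} := by
    rintro u v i j hi hj hij hu hv x ⟨hx, ⟨y, hy, rfl⟩ | hx'⟩
    · have := hc.inj y hy i hi (Eq.trans hx hu)
      rw [this]; rfl
    · exact absurd (hc.inj i hi j hj (by rw [← hu, ← hv, ← hx, ← hx'])) hij
  refine ⟨?_, ?_, ?_⟩
  · intro u w hne he
    by_cases hπ : π u = π w
    · obtain ⟨m, m', h1, h2, h3⟩ := h.paths u w hne hπ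
      exact ⟨m, m', h1.mono_set (hmono u), h2.mono_set (hmono u), h3⟩
    · obtain ⟨⟨i, hi, hiu⟩, ⟨j, hj, hjw⟩⟩ := mem_of_mergeFibres_eq hc.pos he hπ
      have hij : i ≠ j := by rintro rfl; exact hπ (hiu.trans hjw.symm)
      have hu0 : π' u = π (c 0) := mergeFibres_of_mem ⟨i, hi, hiu⟩
      obtain ⟨m, m', h1, h2, -⟩ := attach u i hiu
      obtain ⟨b, b', g1, g2, g3⟩ := reach w i j hi hj hij hjw
      have hs := hsep u w i j hi hj hij hiu hjw
      have hsub : {x | π x = π u} ∪ (c '' Set.Iio n ∪ {x | π x = π w}) ⊆ {x | π' x = π' u} := by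
        refine Set.union_subset (hmono u) (Set.union_subset ?_ ?_)
        · rw [hu0]; exact hcsub
        · rw [he]; exact hmono w
      refine ⟨m + b, b' + m', (h1.concat g1 hs).mono_set hsub, ?_, by omega⟩
      exact (g2.concat h2 (by rwa [Set.inter_comm])).mono_set (by rwa [Set.union_comm])
  · intro u v he hr
    by_cases hπ : π u = π v
    · exact h.colour u v hπ hr
    right
    obtain ⟨⟨i, hi, hiu⟩, ⟨j, hj, hjv⟩⟩ := mem_of_mergeFibres_eq hc.pos he hπ
    have hij : i ≠ j := by rintro rfl; exact hπ (hiu.trans hjv.symm)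
    have hcij : π (c i) ≠ π (c j) := fun e => hij (hc.inj i hi j hj e)
    -- An arc between two cycle vertices is handled by `ψ`. Otherwise an end off the cycle is
    -- separated from the other end by the cycle vertex of its own fibre, and `φ` applies.
    by_cases hu : u = c i
    · by_cases hv : v = c j
      · subst hu hv
        exact Or.inr (hψ i hi j hj (fun e => hcij (congrArg π e)) hr)
      · left
        obtain ⟨m, m', h1, h2, h3⟩ := attach v j hjv
        obtain ⟨b, b', g1, g2, g3⟩ := reach u j i hj hi hij.symm hiu
        refine hR.potential_ne hlk hN hM g1 g2 h2 h1 ?_ ?_ hv g3 (by have := h3 hv; omega) hr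
        · rw [Set.inter_comm]; exact hsep v u j i hj hi hij.symm hjv hiu
        · rw [hu]; exact fun e => hcij (congrArg π e)
    · left
      obtain ⟨m, m', h1, h2, h3⟩ := attach u i hiu
      obtain ⟨b, b', g1, g2, g3⟩ := reach v i j hi hj hij hjv
      refine hR.potential_ne hlk hN hM h2 h1 g1 g2 (hsep u v i j hi hj hij hiu hjv) hu ?_
        (by have := h3 hu; omega) g3 hr
      rintro rfl
      exact hcij hjv
  · intro t X Y hNt hZ
    exact hR.closed_mergeFibres hkN (hlk.trans hkN) h.closed hc hmax hNt hZ

open Classical in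
/-- The labels can be made compatible with any given cycle of the quotient. -/
theorem IsCactusPartition.exists_relabel {V α β : Type*} {M : ℕ} {R : V → V → Prop} {N : ℕ}
    {π : V → α} {φ : V → ZMod M} {ψ : V → β} (h : IsCactusPartition R N π φ ψ)
    {n : ℕ} {c : ℕ → V} (hc : IsQuotCycle R π n c c) (r : ℕ → ZMod M) (χ : V → β) :
    ∃ (φ' : V → ZMod M) (ψ' : V → β), IsCactusPartition R N π φ' ψ' ∧
      ∀ i < n, φ' (c i) = r i ∧ ψ' (c i) = χ (c i) := by
  let s : V → ZMod M := fun v => if hv : ∃ i < n, π v = π (c i) then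
    r hv.choose - φ (c hv.choose) else 0
  let σ : V → Equiv.Perm β := fun v => if hv : ∃ i < n, π v = π (c i) then
    Equiv.swap (ψ (c hv.choose)) (χ (c hv.choose)) else 1
  refine ⟨_, _, h.relabel s σ ?_ ?_, ?_⟩
  · intro u v he; simp only [s, he]
  · intro u v he; simp only [σ, he]
  · intro i hi
    have hex : ∃ j < n, π (c i) = π (c j) := ⟨i, hi, rfl⟩
    -- The cycle meets each fibre once, so one translation and one transposition per fibre impose no
    -- conflicting demands.
    have hch : hex.choose = i := (hc.inj i hi _ hex.choose_spec.1 hex.choose_spec.2).symm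
    constructor
    · simp only [s, dif_pos hex, hch]; ring
    · simp only [σ, dif_pos hex, hch, Equiv.swap_apply_left]

theorem IsQuotCycle.le_card {V α : Type*} [Finite V] {R : V → V → Prop} {π : V → α} {n : ℕ}
    {X Y : ℕ → V} (h : IsQuotCycle R π n X Y) : n ≤ Nat.card V := by
  have := Nat.card_le_card_of_injective (fun i : Fin n => X i) fun i j hij =>
    Fin.ext (h.inj i i.isLt j j.isLt (congrArg π hij))
  simpa using this

/-- Repeatedly merging the fibres of a longest cycle ends with a quotient without long cycles. -/
theorem NoTwoBlocks.exists_isCactusPartition {V : Type*} [Finite V] {R : V → V → Prop}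
    {k l M N : ℕ} (hR : NoTwoBlocks R k l) (hl : 1 ≤ l) (hlk : l ≤ k) (hkN : k ≤ N)
    (hN2 : 2 ≤ N) (hN : 2 * k ≤ N + 2) (hM1 : 1 ≤ M) (hM : 4 * l < M + 4) (hMN : M ≤ N + 1) :
    ∃ (π : V → V) (φ : V → ZMod M) (ψ : V → Fin (k + l + 1)), IsCactusPartition R N π φ ψ ∧
      ∀ n X Y, IsQuotCycle R π n X Y → n < N := by
  suffices H : ∀ (d : ℕ) (π : V → V) (φ : V → ZMod M) (ψ : V → Fin (k + l + 1)),
      (Set.range π).ncard = d → IsCactusPartition R N π φ ψ →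
      ∃ (π : V → V) (φ : V → ZMod M) (ψ : V → Fin (k + l + 1)), IsCactusPartition R N π φ ψ ∧
      ∀ n X Y, IsQuotCycle R π n X Y → n < N from
    H _ _ _ _ rfl (IsCactusPartition.discrete R N (fun _ => 0) (fun _ => 0))
  intro d
  induction d using Nat.strong_induction_on with
  | _ d ih =>
  intro π φ ψ hd hπ
  by_cases hlong : ∀ n X Y, IsQuotCycle R π n X Y → n < N
  · exact ⟨π, φ, ψ, hπ, hlong⟩
  push Not at hlong
  obtain ⟨n, ⟨X, Y, hXY, hNn⟩, hmax⟩ : ∃ n, (∃ X Y, IsQuotCycle R π n X Y ∧ N ≤ n) ∧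
      ∀ m X Y, IsQuotCycle R π m X Y → m ≤ n := by
    classical
    let P : ℕ → Prop := fun n => ∃ X Y, IsQuotCycle R π n X Y ∧ N ≤ n
    obtain ⟨n₀, X₀, Y₀, h₀, hn₀⟩ := hlong
    have hP₀ : P n₀ := ⟨X₀, Y₀, h₀, hn₀⟩
    refine ⟨Nat.findGreatest P (Nat.card V), Nat.findGreatest_spec h₀.le_card hP₀, ?_⟩
    intro m X Y hm
    by_cases hNm : N ≤ m
    · exact Nat.le_findGreatest hm.le_card ⟨X, Y, hm, hNm⟩
    · have : n₀ ≤ _ := Nat.le_findGreatest h₀.le_card hP₀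
      omega
  -- Entry and exit vertices coincide by closedness, so the quotient cycle is a directed cycle of
  -- `R`.
  have hc : IsQuotCycle R π n X X := by
    have e := hπ.closed n X Y hNn hXY
    refine ⟨hXY.pos, fun _ _ => rfl, fun i hi => ?_, ?_, hXY.inj⟩
    · rw [e i (by omega)]; exact hXY.adj i hi
    · rw [e (n - 1) (by omega)]; exact hXY.close
  obtain ⟨r, hr, hr0⟩ := exists_cyclic_potential hM1 hc.pos (hMN.trans (by omega : N + 1 ≤ n + 1))
  obtain ⟨χ, hχ⟩ := hR.exists_coloring_cycle (by omega) hl hc.to_id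
  obtain ⟨φ', ψ', h', hlab⟩ := hπ.exists_relabel hc r χ
  have hm := h'.merge hR hlk hkN hN hM hc hNn hmax
    ⟨hc.pos, fun _ _ => rfl, fun i hi => ⟨hc.adj i hi, ?_⟩, ⟨hc.close, ?_⟩, hc.to_id.inj⟩ ?_
  · refine ih _ ?_ (mergeFibres π n X) φ' ψ' rfl hm
    rw [← hd]
    refine Set.ncard_lt_ncard ⟨?_, ?_⟩ (Set.toFinite _)
    · rintro x ⟨v, rfl⟩
      by_cases hv : ∃ i < n, π v = π (X i)
      · exact ⟨X 0, (mergeFibres_of_mem hv).symm⟩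
      · exact ⟨v, (mergeFibres_of_notMem hv).symm⟩
    -- The value `π (X 1)` disappears from the range, since its fibre now carries the value `π (X
    -- 0)`; this termination step needs `2 ≤ N`.
    · intro hsub
      obtain ⟨v, hv⟩ := hsub ⟨X 1, rfl⟩
      by_cases hvm : ∃ i < n, π v = π (X i)
      · rw [mergeFibres_of_mem hvm] at hv
        have := hc.inj 0 (by omega) 1 (by omega) hv
        omega
      · rw [mergeFibres_of_notMem hvm] at hv
        exact hvm ⟨1, by omega, hv⟩
  · rw [(hlab i (by omega)).1, (hlab (i + 1) hi).1]; exact hr i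
  · rw [(hlab 0 hc.pos).1, (hlab (n - 1) (by omega)).1]; exact hr0
  · intro i hi j hj hne hij
    rw [(hlab i hi).2, (hlab j hj).2]
    exact hχ i hi j hj hne hij

/-! ### Colouring the quotient and the finite case -/

/-- The quotient of the relation `R` by the fibres of `π`. -/
def QuotAdj {V α : Type*} (R : V → V → Prop) (π : V → α) (w w' : Set.range π) : Prop :=
  ∃ u v, π u = w ∧ π v = w' ∧ R u v

theorem reflTransGen_quotAdj {V α : Type*} {R : V → V → Prop} (π : V → α)
    (hs : ∀ u v, Relation.ReflTransGen R u v) (w w' : Set.range π) :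
    Relation.ReflTransGen (QuotAdj R π) w w' := by
  obtain ⟨-, u, rfl⟩ := w
  obtain ⟨-, v, rfl⟩ := w'
  exact (hs u v).lift (fun x => (⟨π x, x, rfl⟩ : Set.range π))
    fun a b hab => ⟨a, b, rfl, rfl, hab⟩

theorem exists_isQuotCycle {V α : Type*} {R : V → V → Prop} {π : V → α} {w w' : Set.range π}
    {n : ℕ} (h : HasPath (QuotAdj R π) Set.univ w' w n) (hw : QuotAdj R π w w') :
    ∃ X Y, IsQuotCycle R π (n + 1) X Y := by
  obtain ⟨p, p0, p1, p2, p3, -⟩ := h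
  have key : ∀ i, ∃ y x, i ≤ n → π y = p i ∧ π x = (if i < n then p (i + 1) else p 0) ∧ R y x := by
    intro i
    by_cases hi : i < n
    · obtain ⟨y, x, h1, h2, h3⟩ := p2 i hi
      exact ⟨y, x, fun _ => ⟨h1, by simp [hi, h2], h3⟩⟩
    · obtain ⟨y, x, h1, h2, h3⟩ := hw
      refine ⟨y, x, fun hin => ⟨?_, ?_, h3⟩⟩
      · rw [show i = n by omega, p1, h1]
      · rw [if_neg hi, p0, h2]
  choose y x hyx using key
  have hX : ∀ i ≤ n, π (if i = 0 then x n else x (i - 1)) = p i := by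
    intro i hi
    rcases Nat.eq_zero_or_pos i with rfl | h0
    · simpa using (hyx n le_rfl).2.1
    · have := (hyx (i - 1) (by omega)).2.1
      rw [if_pos (by omega), Nat.sub_add_cancel h0] at this
      rw [if_neg h0.ne', this]
  -- Fibre `i` is left at the tail `y i` of the `i`-th lifted arc and entered at the head of the
  -- previous one; fibre `0` is entered by the closing arc, which has index `n`.
  refine ⟨fun i => if i = 0 then x n else x (i - 1), y, Nat.succ_pos n, ?_, ?_, ?_, ?_⟩
  · intro i hi
    rw [hX i (by omega), (hyx i (by omega)).1]
  · intro i hi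
    simpa using (hyx i (by omega)).2.2
  · simpa using (hyx n le_rfl).2.2
  · intro i hi j hj hij
    rw [hX i (by omega), hX j (by omega)] at hij
    exact p3 i (by omega) j (by omega) (Subtype.ext hij)

/-- A finite strong digraph without two-block cycles is properly coloured by triples. -/
theorem NoTwoBlocks.exists_coloring {V : Type*} [Finite V] {R : V → V → Prop} {k l M N : ℕ}
    (hR : NoTwoBlocks R k l) (hs : ∀ u v, Relation.ReflTransGen R u v) (hl : 1 ≤ l) (hlk : l ≤ k)
    (hkN : k ≤ N + 1) (hN1 : 1 ≤ N) (hN : 2 * k ≤ N + 3) (hM1 : 1 ≤ M) (hM : 4 * l < M + 4)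
    (hMN : M ≤ N + 2) :
    ∃ f : V → ZMod N × ZMod M × Fin (k + l + 1), ∀ u v, u ≠ v → R u v → f u ≠ f v := by
  obtain ⟨π, φ, ψ, hπ, hlong⟩ := hR.exists_isCactusPartition (M := M) (N := N + 1) hl hlk hkN
    (by omega) (by omega) hM1 hM hMN
  obtain ⟨x, hx⟩ := exists_coloring_of_forall_cycle_length_le (QuotAdj R π)
    (reflTransGen_quotAdj π hs) N hN1 fun w w' n _ hp hw => by
      obtain ⟨X, Y, hXY⟩ := exists_isQuotCycle hp hw
      have := hlong _ X Y hXY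
      omega
  refine ⟨fun v => (((x ⟨π v, v, rfl⟩ : ℤ) : ZMod N), φ v, ψ v), fun u v huv hr he => ?_⟩
  simp only [Prod.mk.injEq] at he
  obtain ⟨h1, h2, h3⟩ := he
  by_cases hπuv : π u = π v
  · rcases hπ.colour u v hπuv hr with h | h | h
    · exact huv h
    · exact h h2
    · exact h h3
  · refine hx ⟨π u, u, rfl⟩ ⟨π v, v, rfl⟩ (fun e => hπuv (congrArg Subtype.val e))
      ⟨u, v, rfl, rfl, hr⟩ ?_
    exact (ZMod.intCast_eq_intCast_iff_dvd_sub _ _ _).1 h1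

/-! ### Reduction to finite digraphs -/

theorem HasPath.map {V W : Type*} {R : V → V → Prop} {R' : W → W → Prop} {S : Set V} {u v : V}
    {n : ℕ} (h : HasPath R S u v n) {f : V → W} (hf : Function.Injective f)
    (hR : ∀ a b, R a b → R' (f a) (f b)) : HasPath R' (f '' S) (f u) (f v) n := by
  obtain ⟨p, p0, p1, p2, p3, p4⟩ := h
  exact ⟨f ∘ p, congrArg f p0, congrArg f p1, fun i hi => hR _ _ (p2 i hi),
    fun i hi j hj hij => p3 i hi j hj (hf hij), fun i hi => Set.mem_image_of_mem f (p4 i hi)⟩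

theorem NoTwoBlocks.subtype {V : Type*} {R : V → V → Prop} {k l : ℕ} (h : NoTwoBlocks R k l)
    (t : Set V) : NoTwoBlocks (fun a b : t => R a b) k l := by
  intro S T a b m n hab hS hT hST hm hn
  refine h _ _ a b m n (fun e => hab (Subtype.ext e))
    (hS.map Subtype.val_injective fun _ _ h => h) (hT.map Subtype.val_injective fun _ _ h => h)
    ?_ hm hn
  rw [← Set.image_inter Subtype.val_injective]
  rintro x ⟨y, hy, rfl⟩
  rcases hST hy with rfl | hy
  · exact Or.inl rfl
  · exact Or.inr (congrArg Subtype.val hy)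

theorem reflTransGen_subtype {V : Type*} {R : V → V → Prop} {t : Set V} (p : ℕ → V) {n : ℕ}
    (hp : ∀ i < n, R (p i) (p (i + 1))) (ht : ∀ i ≤ n, p i ∈ t) {i j : ℕ} (hij : i ≤ j)
    (hj : j ≤ n) : Relation.ReflTransGen (fun a b : t => R a b) ⟨p i, ht i (hij.trans hj)⟩
      ⟨p j, ht j hj⟩ := by
  induction j, hij using Nat.le_induction with
  | base => exact Relation.ReflTransGen.refl
  | succ j _ ih => exact (ih (by omega)).tail (hp j (by omega))

/-- Every finite set of vertices of a strong digraph lies in a finite set inducing a strong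
digraph. -/
theorem exists_finite_strong_superset {V : Type*} {R : V → V → Prop}
    (hs : ∀ u v, Relation.ReflTransGen R u v) {s : Set V} (hfin : s.Finite) :
    ∃ t : Set V, t.Finite ∧ s ⊆ t ∧
      ∀ u v : t, Relation.ReflTransGen (fun a b : t => R a b) u v := by
  rcases s.eq_empty_or_nonempty with rfl | ⟨r, -⟩
  · exact ⟨∅, Set.finite_empty, subset_rfl, fun u => u.2.elim⟩
  choose m p p0 p1 p2 _ _ using fun a => HasPath.of_reflTransGen (hs r a)
  choose n q q0 q1 q2 _ _ using fun a => HasPath.of_reflTransGen (hs a r)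
  -- A path from the root `r` to each vertex of `s` and a path back are added; every vertex added
  -- lies on a closed walk through `r`.
  let t : Set V := insert r (⋃ a ∈ s, (p a '' Set.Iic (m a) ∪ q a '' Set.Iic (n a)))
  have hp : ∀ a ∈ s, ∀ i ≤ m a, p a i ∈ t := fun a ha i hi =>
    Or.inr (Set.mem_biUnion ha (Or.inl ⟨i, hi, rfl⟩))
  have hq : ∀ a ∈ s, ∀ i ≤ n a, q a i ∈ t := fun a ha i hi =>
    Or.inr (Set.mem_biUnion ha (Or.inr ⟨i, hi, rfl⟩))
  have hr : r ∈ t := Or.inl rfl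
  have hst : s ⊆ t := fun a ha => by
    have := hp a ha (m a) le_rfl
    rwa [p1] at this
  have P : ∀ a (ha : a ∈ s) i j (hij : i ≤ j) (hj : j ≤ m a),
      Relation.ReflTransGen (fun a b : t => R a b) ⟨p a i, hp a ha i (hij.trans hj)⟩
        ⟨p a j, hp a ha j hj⟩ := fun a ha i j hij hj =>
    reflTransGen_subtype (p a) (p2 a) (hp a ha) hij hj
  have Q : ∀ a (ha : a ∈ s) i j (hij : i ≤ j) (hj : j ≤ n a),
      Relation.ReflTransGen (fun a b : t => R a b) ⟨q a i, hq a ha i (hij.trans hj)⟩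
        ⟨q a j, hq a ha j hj⟩ := fun a ha i j hij hj =>
    reflTransGen_subtype (q a) (q2 a) (hq a ha) hij hj
  have root : ∀ u : t, Relation.ReflTransGen (fun a b : t => R a b) ⟨r, hr⟩ u ∧
      Relation.ReflTransGen (fun a b : t => R a b) u ⟨r, hr⟩ := by
    rintro ⟨u, hu⟩
    rcases id hu with rfl | hu'
    · exact ⟨Relation.ReflTransGen.refl, Relation.ReflTransGen.refl⟩
    · obtain ⟨a, ha, hu'⟩ := Set.mem_iUnion₂.1 hu'
      have e1 : (⟨p a 0, hp a ha 0 (by omega)⟩ : t) = ⟨r, hr⟩ := Subtype.ext (p0 a)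
      have e2 : (⟨p a (m a), hp a ha _ le_rfl⟩ : t) = ⟨q a 0, hq a ha 0 (by omega)⟩ :=
        Subtype.ext ((p1 a).trans (q0 a).symm)
      have e3 : (⟨q a (n a), hq a ha _ le_rfl⟩ : t) = ⟨r, hr⟩ := Subtype.ext (q1 a)
      rcases hu' with ⟨i, hi, rfl⟩ | ⟨i, hi, rfl⟩
      · have h1 := P a ha 0 i (by omega) hi
        have h2 := P a ha i (m a) hi le_rfl
        have h3 := Q a ha 0 (n a) (by omega) le_rfl
        rw [e1] at h1
        rw [e2] at h2
        rw [e3] at h3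
        exact ⟨h1, h2.trans h3⟩
      · have h1 := P a ha 0 (m a) (by omega) le_rfl
        have h2 := Q a ha 0 i (by omega) hi
        have h3 := Q a ha i (n a) hi le_rfl
        rw [e1, e2] at h1
        rw [e3] at h3
        exact ⟨h1.trans h2, h3⟩
  refine ⟨t, ?_, hst, fun u v => (root u).2.trans (root v).1⟩
  exact (hfin.biUnion fun a _ => ((Set.finite_Iic _).image _).union
    ((Set.finite_Iic _).image _)).insert r

theorem IsStrong.reflTransGen {V : Type*} {D : Digraph V} (h : IsStrong D) (u v : V) :
    Relation.ReflTransGen D.Adj u v := by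
  obtain ⟨p, h1, h2, h3, -⟩ := h u v
  clear h
  induction p generalizing u with
  | nil => simp at h1
  | cons a p ih =>
    obtain rfl : a = u := by simpa using h1
    cases p with
    | nil =>
      obtain rfl : a = v := by simpa using h2
      exact Relation.ReflTransGen.refl
    | cons b p =>
      rw [List.isChain_cons_cons] at h3
      exact Relation.ReflTransGen.head h3.1 (ih b rfl (by simpa using h2) h3.2)

/-! ### Counting colours and the conclusion -/

theorem cactus_bound_le {k l : ℕ} (hl : 1 ≤ l) (hlk : l ≤ k) (hk : 3 ≤ k) :
    (4 * k - 5) * ((4 * l - 3) * (k + l + 1)) ≤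
      (k + l - 2) * (k + l - 3) * (2 * l + 2) * (k + l + 1) := by
  rw [← mul_assoc]
  refine Nat.mul_le_mul_right _ ?_
  obtain ⟨a, rfl⟩ := Nat.exists_eq_add_of_le hl
  obtain ⟨b, rfl⟩ := Nat.exists_eq_add_of_le hk
  rw [show 4 * (3 + b) - 5 = 4 * b + 7 by omega, show 4 * (1 + a) - 3 = 4 * a + 1 by omega,
    show 3 + b + (1 + a) - 2 = a + b + 2 by omega, show 3 + b + (1 + a) - 3 = a + b + 1 by omega]
  rcases Nat.lt_or_ge a 3 with ha | ha
  · interval_cases a <;> nlinarith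
  -- With `l = 4 + a` and `k = 4 + a + b`, the inequality of the two polynomials in `a` and `b`
  -- holds coefficient by coefficient.
  · obtain ⟨a, rfl⟩ := Nat.exists_eq_add_of_le ha
    obtain ⟨b, rfl⟩ := Nat.exists_eq_add_of_le (show a + 1 ≤ b by omega)
    ring_nf
    nlinarith

theorem mainTheorem2 (k l : ℕ) (hl : 1 ≤ l) (hk : max l 3 ≤ k)
    {V : Type*} (D : Digraph V) (hstrong : IsStrong D)
    (hfree : ¬ ContainsSubdivision (twoBlockCycle k l) D) :
    digraphChromaticNumber D ≤
      (((k + l - 2) * (k + l - 3) * (2 * l + 2) * (k + l + 1) : ℕ) : ℕ∞) := by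
  have hlk : l ≤ k := (le_max_left _ _).trans hk
  have hk3 : 3 ≤ k := (le_max_right _ _).trans hk
  have hR := noTwoBlocks_of_not_containsSubdivision D (by omega) hl hfree
  have : NeZero (4 * k - 5) := ⟨by omega⟩
  have : NeZero (4 * l - 3) := ⟨by omega⟩
  obtain ⟨f⟩ : Nonempty (D.toSimpleGraphInclusive.Coloring
      (ZMod (4 * k - 5) × ZMod (4 * l - 3) × Fin (k + l + 1))) := by
    -- By compactness (de Bruijn–Erdős) finite subgraphs suffice; each is enlarged to a finite
    -- strong induced subdigraph.
    refine SimpleGraph.nonempty_hom_of_forall_finite_subgraph_hom fun G' hG' => ?_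
    refine Classical.choice ?_
    obtain ⟨t, ht, hst, hts⟩ := exists_finite_strong_superset hstrong.reflTransGen hG'
    have := ht.to_subtype
    -- The modulus must exceed `4l - 4`, twice the length `2l - 2` of the short dipaths. The choice
    -- of `N` ensures `M ≤ N + 2` for every `l ≤ k`, so that a potential exists on each contracted
    -- cycle.
    obtain ⟨f, hf⟩ := (hR.subtype t).exists_coloring (N := 4 * k - 5) (M := 4 * l - 3) hts hl hlk
      (by omega) (by omega) (by omega) (by omega) (by omega) (by omega)
    refine ⟨⟨fun v => f ⟨v, hst v.2⟩, fun {u v} huv => ?_⟩⟩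
    obtain ⟨hne, hadj | hadj⟩ := G'.adj_sub huv
    · exact hf _ _ (fun e => hne (Subtype.mk.inj e)) hadj
    · exact (hf _ _ (fun e => hne (Subtype.mk.inj e).symm) hadj).symm
  have hcol := f.colorable
  rw [Fintype.card_prod, Fintype.card_prod, ZMod.card, ZMod.card, Fintype.card_fin] at hcol
  exact (hcol.mono (cactus_bound_le hl hlk hk3)).chromaticNumber_le
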